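/- Let $f:\mathbb R^n\to\mathbb R$ ($n\ge 1$) be three times continuously differentiable, with $f(x)\ge f_{\rm low}$, $\|\nabla^3 f(x)-\nabla^3 f(y)\|\le L\|x-y\|$ (with $L\ge 3$) and $\|\nabla^3 f(x)\|\le\kappa$ for all $x,y\in\mathbb R^n$, where $\|T\|=\max_{\|s_i\|=1}|T[s_1,s_2,s_3]|$. Fix $x_0\in\mathbb R^n$, $\sigma_0>0$, $\theta_1,\theta_2>1$ and an integer $m\ge1$, and put $\|s_j\|=1$ for $j<0$. For $k=0,1,2,\dots$ the algorithm computes a symmetric tensor $T_k$ (see below), puts $$\overline T_k(s)=f(x_k)+\nabla f(x_k)[s]+\tfrac12\nabla^2f(x_k)[s]^2+\tfrac1{3!}T_k[s]^3,\qquad m_k(s)=\overline T_k(s)+\tfrac{\sigma_k}{4!}\|s\|^4,$$ chooses any step $s_k$ with $$m_k(s_k)\le m_k(0),\quad \|\nabla\overline T_k(s_k)\|\le\tfrac{\theta_1\sigma_k\|s_k\|^3}{3!},\quad \max[0,-\lambda_{\min}(\nabla^2\overline T_k(s_k))]\le\tfrac{\theta_2\sigma_k\|s_k\|^2}{2!},$$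 and sets $x_{k+1}=x_k+s_k$, $\sigma_{k+1}=\sigma_k+\sigma_k\|s_k\|^4$. If $k \bmod m\ne0$, then $T_k$ is the PSB update: the minimizer of $\|T-T_{k-1}\|_F$ over all symmetric third-order tensors $T$ with $T[s_{k-1}]=\nabla^2f(x_k)-\nabla^2f(x_{k-1})$. If $k\bmod m=0$, then (a) in the variant with exact restarts, $T_k=\nabla^3f(x_k)$; (b) in the variant with finite-difference restarts, $T_k=P_{\rm sym}\Big(\sum_{i=1}^n\frac{\nabla^2f(x_k+h_ke_i)-\nabla^2f(x_k)}{h_k}\otimes e_i\Big)$ with $h_k=\min\big(\sum_{i=1}^m\|s_{k-i}\|,1\big)/\sqrt n$, where $P_{\rm sym}$ is the projection onto symmetric tensors. Each iteration evaluates $\nabla f(x_k)$ and $\nabla^2 f(x_k)$ once; a restart evaluates in addition, in (a), $\nabla^3f(x_k)$ and, in (b), the $n$ Hessians $\nabla^2f(x_k+h_ke_i)$. Then for each variant there is a constant $C>0$, which depends only on $m,\sigma_0,\theta_1,\theta_2,L,\kappa$ and on upper bounds for $f(x_0)-f_{\rm low}$, $\|\nabla f(x_0)\|$ and $\max[0,-\lambda_{\min}(\nabla^2f(x_0))]$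 (in particular, not on $n$), such that for every run and all $\epsilon_1,\epsilon_2>0$ with $\min(\epsilon_1,\epsilon_2)\le1$ some iterate $x_K$ satisfies $$\|\nabla f(x_K)\|\le\epsilon_1\quad\text{and}\quad\lambda_{\min}(\nabla^2f(x_K))\ge-\epsilon_2,$$ and the total number of evaluations made in iterations $0,\dots,K$ is (a) at most $C\max[\epsilon_1^{-4/3},\epsilon_2^{-2}]$ evaluations of the gradient, the Hessian and the third-order tensor for exact restarts; (b) at most $C\,n\max[\epsilon_1^{-4/3},\epsilon_2^{-2}]$ evaluations of the gradient and the Hessian for finite-difference restarts. -/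

import Mathlib

namespace PSBThree

/-- `ℝⁿ` with its Euclidean norm. -/
abbrev Vec (n : ℕ) := EuclideanSpace ℝ (Fin n)

/-- Multilinear maps `(ℝⁿ)^p → ℝ`. Their Mathlib norm is the operator norm
`max {|T[s₁, …, s_p]| : ‖s_i‖ = 1}`. -/
abbrev Tensor (p n : ℕ) := ContinuousMultilinearMap ℝ (fun _ : Fin p => Vec n) ℝ

/-- The `i`-th vector of the canonical basis of `ℝⁿ`. -/
noncomputable def basisVec {n : ℕ} (i : Fin n) : Vec n := EuclideanSpace.single i (1 : ℝ)

/-- `T` is symmetric: `T[s_{π(1)}, …, s_{π(p)}] = T[s₁, …, s_p]` for every permutation `π`. -/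
def IsSymmTensor {p n : ℕ} (T : Tensor p n) : Prop :=
  ∀ (π : Equiv.Perm (Fin p)) (v : Fin p → Vec n), T (fun i => v (π i)) = T v

/-- The projection `P_sym(T) = (1/p!) ∑_π π(T)`, where `π(T)[s₁, …] = T[s_{π(1)}, …]`. -/
noncomputable def symProj {p n : ℕ} (T : Tensor p n) : Tensor p n :=
  ((Nat.factorial p : ℝ)⁻¹) •
    ∑ π : Equiv.Perm (Fin p), ContinuousMultilinearMap.domDomCongr π T

/-- The Frobenius norm, the Euclidean norm of the array of the entries
`T[e_{i₁}, …, e_{i_p}]`. -/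
noncomputable def frobNorm {p n : ℕ} (T : Tensor p n) : ℝ :=
  Real.sqrt (∑ i : Fin p → Fin n, (T fun j => basisVec (i j)) ^ 2)

/-- The tensor `S ⊗ u`, that is `(S ⊗ u)[s₁, …, s_p, s_{p+1}] = S[s₁, …, s_p] · uᵀ s_{p+1}`. -/
noncomputable def outer {p n : ℕ} (S : Tensor p n) (u : Vec n) : Tensor (p + 1) n :=
  (S.smulRight (innerSL ℝ u)).uncurryRight

theorem symProj_apply {p n : ℕ} (T : Tensor p n) (v : Fin p → Vec n) :
    symProj T v =
      (Nat.factorial p : ℝ)⁻¹ * ∑ π : Equiv.Perm (Fin p), T (fun i => v (π i)) := by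
  simp [symProj]

theorem outer_apply {p n : ℕ} (S : Tensor p n) (u : Vec n) (v : Fin (p + 1) → Vec n) :
    outer S u v = S (fun i => v i.castSucc) * inner ℝ u (v (Fin.last p)) := by
  simp [outer, Fin.init_def]

/-- The matrix of second partial derivatives of `f` at `x`. -/
noncomputable def hessMatrix {n : ℕ} (f : Vec n → ℝ) (x : Vec n) : Matrix (Fin n) (Fin n) ℝ :=
  Matrix.of fun i j => iteratedFDeriv ℝ 2 f x ![basisVec i, basisVec j]

/-- The leftmost eigenvalue of a real symmetric matrix (of size at least one). -/
noncomputable def lambdaMin {n : ℕ} (M : Matrix (Fin n) (Fin n) ℝ) : ℝ :=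
  sInf (spectrum ℝ M)

/-- The approximate third-order Taylor expansion at `x`, as a function of the step `s`:
the third derivative is replaced by the tensor `T`. -/
noncomputable def approxTaylor {n : ℕ} (f : Vec n → ℝ) (x : Vec n) (T : Tensor 3 n)
    (s : Vec n) : ℝ :=
  f x + ∑ i ∈ Finset.Icc 1 2, 1 / (Nat.factorial i : ℝ) * iteratedFDeriv ℝ i f x (fun _ => s)
    + 1 / (Nat.factorial 3 : ℝ) * T (fun _ => s)

/-- The regularized model `m(s)` of `f (x + s)`. -/
noncomputable def model {n : ℕ} (f : Vec n → ℝ) (x : Vec n) (T : Tensor 3 n) (σ : ℝ)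
    (s : Vec n) : ℝ :=
  approxTaylor f x T s + σ / (Nat.factorial 4 : ℝ) * ‖s‖ ^ 4

/-- The tests that an acceptable trial step `s` passes: decrease of the model, and
approximate first- and second-order stationarity of the approximate Taylor expansion
(its gradient and its Hessian are taken with respect to the step). -/
structure IsTrialStep {n : ℕ} (f : Vec n → ℝ) (θ₁ θ₂ : ℝ) (x : Vec n) (T : Tensor 3 n)
    (σ : ℝ) (s : Vec n) : Prop where
  decrease : model f x T σ s - model f x T σ 0 ≤ 0
  first_order :
    ‖gradient (approxTaylor f x T) s‖ ≤ θ₁ * σ * ‖s‖ ^ 3 / (Nat.factorial 3 : ℝ)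
  second_order :
    max 0 (-lambdaMin (hessMatrix (approxTaylor f x T) s))
      ≤ θ₂ * σ * ‖s‖ ^ 2 / (Nat.factorial 2 : ℝ)

/-- The sequences produced by the algorithm: iterates, steps, regularization parameters and
approximations of the third derivative. -/
structure Iterates (n : ℕ) where
  x : ℕ → Vec n
  s : ℕ → Vec n
  σ : ℕ → ℝ
  T : ℕ → Tensor 3 n

/-- The part of the algorithm that does not depend on how the tensors `T k` are computed.
Every step is accepted, and any step that passes the tests may be taken. -/
structure IsRun {n : ℕ} (f : Vec n → ℝ) (θ₁ θ₂ σ₀ : ℝ) (x₀ : Vec n) (R : Iterates n) :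
    Prop where
  x_zero : R.x 0 = x₀
  σ_zero : R.σ 0 = σ₀
  step : ∀ k, IsTrialStep f θ₁ θ₂ (R.x k) (R.T k) (R.σ k) (R.s k)
  x_succ : ∀ k, R.x (k + 1) = R.x k + R.s k
  σ_succ : ∀ k, R.σ (k + 1) = R.σ k + R.σ k * ‖R.s k‖ ^ 4

/-- The symmetric tensors that satisfy the secant equation `T[s] = Y`. -/
def secantSet {n : ℕ} (s : Vec n) (Y : Tensor 2 n) : Set (Tensor 3 n) :=
  {T | IsSymmTensor T ∧ T.curryLeft s = Y}

/-- The high-order PSB update: `T` is the symmetric tensor closest to `Tprev` in the Frobenius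
norm among those that satisfy the secant equation `T[s] = Y`. -/
def IsPSBUpdate {n : ℕ} (Tprev : Tensor 3 n) (s : Vec n) (Y : Tensor 2 n) (T : Tensor 3 n) :
    Prop :=
  T ∈ secantSet s Y ∧ ∀ T' ∈ secantSet s Y, frobNorm (T - Tprev) ≤ frobNorm (T' - Tprev)

/-- The secant update that is made at every iteration `k` with `k mod m ≠ 0`. -/
def PSBBetweenRestarts {n : ℕ} (f : Vec n → ℝ) (m : ℕ) (R : Iterates n) : Prop :=
  ∀ k, k % m ≠ 0 →
    IsPSBUpdate (R.T (k - 1)) (R.s (k - 1))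
      (iteratedFDeriv ℝ 2 f (R.x k) - iteratedFDeriv ℝ 2 f (R.x (k - 1))) (R.T k)

/-- The finite-difference stepsize `h_k = min (∑_{i=1}^m ‖s_{k-i}‖, 1) / √n`, with the
convention `‖s_j‖ = 1` for `j < 0`. -/
noncomputable def fdStep {n : ℕ} (m : ℕ) (R : Iterates n) (k : ℕ) : ℝ :=
  min (∑ i ∈ Finset.Icc 1 m, if i ≤ k then ‖R.s (k - i)‖ else 1) 1 / Real.sqrt n

/-- The finite-difference tensor
`A = ∑ i, ((∇² f (x + h e_i) - ∇² f (x)) / h) ⊗ e_i`. -/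
noncomputable def fdTensor {n : ℕ} (f : Vec n → ℝ) (x : Vec n) (h : ℝ) : Tensor 3 n :=
  ∑ i : Fin n,
    outer (h⁻¹ • (iteratedFDeriv ℝ 2 f (x + h • basisVec i) - iteratedFDeriv ℝ 2 f x))
      (basisVec i)

/-- A run of the PSB variant with exact restarts: `T_k = ∇³ f (x_k)` if `k mod m = 0`. -/
structure IsLazyRestartRun {n : ℕ} (f : Vec n → ℝ) (m : ℕ) (θ₁ θ₂ σ₀ : ℝ) (x₀ : Vec n)
    (R : Iterates n) : Prop where
  run : IsRun f θ₁ θ₂ σ₀ x₀ R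
  restart : ∀ k, k % m = 0 → R.T k = iteratedFDeriv ℝ 3 f (R.x k)
  psb : PSBBetweenRestarts f m R

/-- A run of the PSB variant with finite-difference restarts: `T_k = P_sym(A_k)` if
`k mod m = 0`. (If `h_k = 0`, then a previous step was zero, and the iterate it was taken from
satisfies `∇ f = 0` and `∇² f ⪰ 0`; what the run does afterwards is irrelevant.) -/
structure IsFDRestartRun {n : ℕ} (f : Vec n → ℝ) (m : ℕ) (θ₁ θ₂ σ₀ : ℝ) (x₀ : Vec n)
    (R : Iterates n) : Prop where
  run : IsRun f θ₁ θ₂ σ₀ x₀ R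
  restart : ∀ k, k % m = 0 → R.T k = symProj (fdTensor f (R.x k) (fdStep m R k))
  psb : PSBBetweenRestarts f m R

/-- A call of the oracle: the evaluation of `∇^order f` at a point. -/
structure Query (n : ℕ) where
  order : ℕ
  point : Vec n

/-- The oracle calls of iteration `k` with exact restarts: the gradient and the Hessian at
`x_k`, and at a restart also the third derivative. (The secant update reuses the Hessian at
`x_{k-1}`; the value `f (x_k)` cancels in every test on the step.) -/
noncomputable def lazyQueries {n : ℕ} (m : ℕ) (R : Iterates n) (k : ℕ) : List (Query n) :=
  [⟨1, R.x k⟩, ⟨2, R.x k⟩] ++ if k % m = 0 then [⟨3, R.x k⟩] else []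

/-- The oracle calls of iteration `k` with finite-difference restarts: the gradient and the
Hessian at `x_k`, and at a restart also the Hessians at the points `x_k + h_k e_i`. -/
noncomputable def fdQueries {n : ℕ} (m : ℕ) (R : Iterates n) (k : ℕ) : List (Query n) :=
  [⟨1, R.x k⟩, ⟨2, R.x k⟩] ++
    if k % m = 0 then List.ofFn fun i : Fin n => ⟨2, R.x k + fdStep m R k • basisVec i⟩ else []

/-- The total number of oracle calls in iterations `0, …, K`. -/
def evalCount {n : ℕ} (queries : ℕ → List (Query n)) (K : ℕ) : ℕ :=
  ∑ k ∈ Finset.range (K + 1), (queries k).length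

/-- The assumptions on the objective function for third-order models. (The lower bound that
is assumed for models of order `p` on the derivatives of order `3, …, p - 1` concerns no
derivative if `p = 3`.) -/
structure ObjectiveAssumptions {n : ℕ} (f : Vec n → ℝ) (flow L κ : ℝ) : Prop where
  smooth : ContDiff ℝ 3 f
  bounded_below : ∀ x, flow ≤ f x
  three_le : 3 ≤ L
  lipschitz : ∀ x y, ‖iteratedFDeriv ℝ 3 f x - iteratedFDeriv ℝ 3 f y‖ ≤ L * ‖x - y‖
  bounded_third : ∀ x, ‖iteratedFDeriv ℝ 3 f x‖ ≤ κ

/-- What the constants may depend on at the starting point: bounds on `f (x₀) - flow`, on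
`‖∇ f (x₀)‖` and on the negative curvature of `∇² f (x₀)`. -/
structure StartBounds {n : ℕ} (f : Vec n → ℝ) (flow : ℝ) (x₀ : Vec n) (Δ G B : ℝ) : Prop where
  gap : f x₀ - flow ≤ Δ
  grad : ‖gradient f x₀‖ ≤ G
  curv : max 0 (-lambdaMin (hessMatrix f x₀)) ≤ B

/-- `x` is an `(ε₁, ε₂)` approximate second-order stationary point of `f`. -/
def IsApproxSecondOrder {n : ℕ} (f : Vec n → ℝ) (ε₁ ε₂ : ℝ) (x : Vec n) : Prop :=
  ‖gradient f x‖ ≤ ε₁ ∧ -ε₂ ≤ lambdaMin (hessMatrix f x)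

end PSBThree

open PSBThree

/-! Everything rests on an operator-norm bound, free of $n$, for the tensor error:
$\|T_k-\nabla^3f(x_k)\|\le 2L\nu_k$, where $\nu_k$ is the sum of the last $2m$ step lengths. Let $H$
be the average of $\nabla^3f$ over the segment of the last step $s$. It satisfies the secant
equation, and the PSB update is $T-H=(T_{\rm prev}-H)\circ P$, with the orthogonal projection $P$
onto $s^\perp$ applied in each slot. Hence the minimization in the Frobenius norm does not increase
the operator norm either (`norm_sub_le_of_isPSBUpdate`), and an update adds at most $2L\|s\|$ to the
error (`norm_psb_error_le`). A restart resets the error to zero, or to $L\,h_k\sqrt n$, where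
$h_k\sqrt n$ is at most a sum of recent step lengths.

With $\mu_k=\|s_k\|+\nu_k$, Taylor's formula bounds the model error by $2L\mu_k^4$, and the gradient
norm and negative curvature at $x_{k+1}$ by constants times $\mu_k^3$ and $\mu_k^2$ as long as
$\sigma_k$ is bounded. What remains is the scalar recursion `IsStepSequence`. Since
$\sigma_K=\sigma_0+\sum_{k<K}\sigma_k\|s_k\|^4$, the summed descent inequality bounds $\sigma_K$:
once $\sigma_k$ is large, half of the decrease absorbs the model errors (`exists_σ_bound`). Then
$\sum\|s_k\|^4$ and $\sum\mu_k^4$ are bounded, whereas each failure of the stationarity test at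
$x_{k+1}$ makes $\mu_k^4$ at least a constant times $\min(\epsilon_1^{4/3},\epsilon_2^2)$. This
bounds the number of failures (`exists_complexity_bound`). -/

namespace PSBThree

/-! ### Derivatives of homogeneous polynomials -/

/-- Chain rule through the linear diagonal map: the `k` directions go into `k` distinct slots in
every possible way, and `x` stays in the others. -/
theorem iteratedFDeriv_diag_apply {p n : ℕ} (A : Tensor p n) (k : ℕ) (x : Vec n)
    (v : Fin k → Vec n) [∀ e : Fin k ↪ Fin p, DecidablePred (· ∈ Set.range e)] :
    iteratedFDeriv ℝ k (fun s => A fun _ => s) x v =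
      ∑ e : Fin k ↪ Fin p, A fun j =>
        if h : j ∈ Set.range e then v (e.toEquivRange.symm ⟨j, h⟩) else x := by
  let g : Vec n →L[ℝ] (Fin p → Vec n) :=
    ContinuousLinearMap.pi fun _ => ContinuousLinearMap.id ℝ (Vec n)
  change iteratedFDeriv ℝ k (A ∘ g) x v = _
  rw [ContinuousLinearMap.iteratedFDeriv_comp_right _ A.contDiff _ le_rfl, A.iteratedFDeriv_eq]
  simp only [ContinuousMultilinearMap.iteratedFDeriv,
    ContinuousMultilinearMap.compContinuousLinearMap_apply, sum_apply,
    ContinuousMultilinearMap.iteratedFDerivComponent_apply]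
  refine Finset.sum_congr rfl fun e _ => ?_
  congr 1
  funext j
  by_cases h : j ∈ Set.range e
  · simp only [h, g, dite_true, ContinuousLinearMap.coe_pi', ContinuousLinearMap.coe_id', id]
    congr!
  · simp [h, g]

theorem iteratedFDeriv_diag_zero {p n k : ℕ} (A : Tensor p n) (h : k < p) :
    iteratedFDeriv ℝ k (fun s => A fun _ => s) 0 = 0 := by
  classical
  ext v
  rw [iteratedFDeriv_diag_apply]
  refine Finset.sum_eq_zero fun e _ => ?_
  obtain ⟨j, hj⟩ : ∃ j, j ∉ Set.range e := by
    by_contra! hc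
    have := Fintype.card_le_of_surjective e fun j => hc j
    simp at this
    omega
  exact A.map_coord_zero j (by simp only [hj, dite_false])

theorem iteratedFDeriv_diag_of_lt {p n k : ℕ} (A : Tensor p n) (h : p < k) (x : Vec n) :
    iteratedFDeriv ℝ k (fun s => A fun _ => s) x = 0 := by
  classical
  ext v
  rw [iteratedFDeriv_diag_apply]
  have : IsEmpty (Fin k ↪ Fin p) := by
    refine ⟨fun e => ?_⟩
    have := Fintype.card_le_of_embedding e
    simp at this
    omega
  simp

theorem IsSymmTensor.iteratedFDeriv_diag {p n : ℕ} {A : Tensor p n} (hA : IsSymmTensor A)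
    (x : Vec n) :
    iteratedFDeriv ℝ p (fun s => A fun _ => s) x = (p.factorial : ℝ) • A := by
  ext v
  rw [ContinuousMultilinearMap.iteratedFDeriv_comp_diagonal]
  simp [hA _ v, Fintype.card_perm]

/-! ### Symmetry of derivatives -/

/-- Adjacent transpositions generate the symmetric group, so symmetry of higher derivatives reduces
to that of second derivatives. -/
theorem isSymmTensor_of_swap {p n : ℕ} {T : Tensor (p + 1) n}
    (h : ∀ (i : Fin p) (v : Fin (p + 1) → Vec n),
      T (fun j => v (Equiv.swap i.castSucc i.succ j)) = T v) : IsSymmTensor T := by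
  intro π
  have hπ : π ∈ Submonoid.closure
      (Set.range fun i : Fin p => Equiv.swap i.castSucc i.succ) := by
    rw [Equiv.Perm.mclosure_swap_castSucc_succ]; trivial
  induction hπ using Submonoid.closure_induction with
  | mem x hx => obtain ⟨i, rfl⟩ := hx; exact h i
  | one => intro v; rfl
  | mul x y _ _ hx hy =>
    intro v
    exact (hy fun j => v (x j)).trans (hx v)

theorem isSymmTensor_iteratedFDeriv_two {n : ℕ} {f : Vec n → ℝ} (hf : ContDiff ℝ 2 f)
    (x : Vec n) : IsSymmTensor (iteratedFDeriv ℝ 2 f x) := by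
  refine isSymmTensor_of_swap (p := 1) fun i v => ?_
  have h := (hf.contDiffAt (x := x)).isSymmSndFDerivAt (by simp)
  obtain rfl : i = 0 := Subsingleton.elim _ _
  exact (iteratedFDeriv_two_apply f x _).trans
    ((h (v 1) (v 0)).trans (iteratedFDeriv_two_apply f x v).symm)

theorem iteratedFDeriv_three_apply {n : ℕ} (f : Vec n → ℝ) (x : Vec n) (v : Fin 3 → Vec n) :
    iteratedFDeriv ℝ 3 f x v = fderiv ℝ (fderiv ℝ (fderiv ℝ f)) x (v 0) (v 1) (v 2) := by
  rw [iteratedFDeriv_succ_apply_right]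
  exact congrArg (fun l : Vec n →L[ℝ] ℝ => l (v 2))
    (iteratedFDeriv_two_apply (fderiv ℝ f) x (Fin.init v))

theorem isSymmTensor_iteratedFDeriv_three {n : ℕ} {f : Vec n → ℝ} (hf : ContDiff ℝ 3 f)
    (x : Vec n) : IsSymmTensor (iteratedFDeriv ℝ 3 f x) := by
  refine isSymmTensor_of_swap (p := 2) fun i v => ?_
  refine (iteratedFDeriv_three_apply f x _).trans
    (Eq.trans ?_ (iteratedFDeriv_three_apply f x v).symm)
  have hf' : ContDiff ℝ 2 (fderiv ℝ f) := hf.fderiv_right (by norm_num)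
  fin_cases i
  · have h := (hf'.contDiffAt (x := x)).isSymmSndFDerivAt (by simp)
    exact congrArg (fun l : Vec n →L[ℝ] ℝ => l (v 2)) (h (v 1) (v 0))
  -- For the last two slots, the symmetry of the second derivative holds at every point and is
  -- differentiated in the direction `v 0`.
  · have hd : DifferentiableAt ℝ (fderiv ℝ (fderiv ℝ f)) x :=
      ((hf'.fderiv_right (m := 1) (by norm_num)).differentiable (by norm_num)) x
    have key : ∀ a b c : Vec n, fderiv ℝ (fderiv ℝ (fderiv ℝ f)) x a b c =
        fderiv ℝ (fun y => fderiv ℝ (fderiv ℝ f) y b c) x a := by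
      intro a b c
      have h1 := (hd.hasFDerivAt.clm_apply (hasFDerivAt_const b x)).clm_apply
        (hasFDerivAt_const c x)
      rw [h1.fderiv]
      simp
    have hs : (fun y => fderiv ℝ (fderiv ℝ f) y (v 2) (v 1)) =
        fun y => fderiv ℝ (fderiv ℝ f) y (v 1) (v 2) := by
      funext y
      exact ((hf.of_le (by norm_num) : ContDiff ℝ 2 f).contDiffAt (x := y)).isSymmSndFDerivAt
        (by simp) (v 2) (v 1)
    exact (key (v 0) (v 2) (v 1)).trans ((congrArg (fun F : Vec n → ℝ => fderiv ℝ F x (v 0))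
      hs).trans (key (v 0) (v 1) (v 2)).symm)

/-! ### The approximate Taylor expansion and its remainder -/

theorem approxTaylor_eq {n : ℕ} (f : Vec n → ℝ) (x : Vec n) (T : Tensor 3 n) :
    approxTaylor f x T =
      (fun _ => f x) + ((fun s => iteratedFDeriv ℝ 1 f x fun _ => s) +
        ((2⁻¹ : ℝ) • (fun s => iteratedFDeriv ℝ 2 f x fun _ => s) +
          (6⁻¹ : ℝ) • (fun s => T fun _ => s))) := by
  funext s
  simp [approxTaylor, Finset.sum_Icc_succ_top, Nat.factorial]
  ring

theorem contDiff_diag {p n : ℕ} (A : Tensor p n) {N : WithTop ℕ∞} :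
    ContDiff ℝ N (fun s : Vec n => A fun _ => s) :=
  A.contDiff.comp (contDiff_pi.2 fun _ => contDiff_id)

theorem contDiff_smul_diag {p n : ℕ} (c : ℝ) (A : Tensor p n) {N : WithTop ℕ∞} :
    ContDiff ℝ N (c • fun s : Vec n => A fun _ => s) :=
  (contDiff_diag A).const_smul c

theorem contDiff_approxTaylor {n : ℕ} (f : Vec n → ℝ) (x : Vec n) (T : Tensor 3 n)
    {N : WithTop ℕ∞} : ContDiff ℝ N (approxTaylor f x T) := by
  rw [approxTaylor_eq]
  exact contDiff_const.add ((contDiff_diag _).add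
    ((contDiff_smul_diag _ _).add (contDiff_smul_diag _ _)))

theorem iteratedFDeriv_approxTaylor {n : ℕ} (f : Vec n → ℝ) (x : Vec n) (T : Tensor 3 n)
    (k : ℕ) (s : Vec n) :
    iteratedFDeriv ℝ k (approxTaylor f x T) s =
      iteratedFDeriv ℝ k (fun _ => f x) s +
        (iteratedFDeriv ℝ k (fun s => iteratedFDeriv ℝ 1 f x fun _ => s) s +
          ((2⁻¹ : ℝ) • iteratedFDeriv ℝ k (fun s => iteratedFDeriv ℝ 2 f x fun _ => s) s +
            (6⁻¹ : ℝ) • iteratedFDeriv ℝ k (fun s => T fun _ => s) s)) := by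
  have h2 : ContDiff ℝ k ((2⁻¹ : ℝ) • (fun s => iteratedFDeriv ℝ 2 f x fun _ => s) +
      (6⁻¹ : ℝ) • (fun s => T fun _ => s)) :=
    (contDiff_smul_diag _ _).add (contDiff_smul_diag _ _)
  have h1 : ContDiff ℝ k ((fun s => iteratedFDeriv ℝ 1 f x fun _ => s) +
      ((2⁻¹ : ℝ) • (fun s => iteratedFDeriv ℝ 2 f x fun _ => s) +
        (6⁻¹ : ℝ) • (fun s => T fun _ => s))) := (contDiff_diag _).add h2
  rw [approxTaylor_eq, iteratedFDeriv_add contDiff_const h1, Pi.add_apply,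
    iteratedFDeriv_add (contDiff_diag _) h2, Pi.add_apply,
    iteratedFDeriv_add (contDiff_smul_diag _ _) (contDiff_smul_diag _ _), Pi.add_apply,
    iteratedFDeriv_const_smul_apply (contDiff_diag _).contDiffAt,
    iteratedFDeriv_const_smul_apply (contDiff_diag _).contDiffAt]

theorem approxTaylor_zero {n : ℕ} (f : Vec n → ℝ) (x : Vec n) (T : Tensor 3 n) :
    approxTaylor f x T 0 = f x := by
  have h : ∀ {p : ℕ} (A : Tensor (p + 1) n), (A fun _ => 0) = 0 :=
    fun A => A.map_coord_zero 0 rfl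
  rw [approxTaylor_eq]
  simp [h]

theorem iteratedFDeriv_one_approxTaylor_zero {n : ℕ} (f : Vec n → ℝ) (x : Vec n)
    (T : Tensor 3 n) :
    iteratedFDeriv ℝ 1 (approxTaylor f x T) 0 = iteratedFDeriv ℝ 1 f x := by
  have h1 : IsSymmTensor (iteratedFDeriv ℝ 1 f x) := fun π v => by
    rw [Subsingleton.elim π 1]; rfl
  rw [iteratedFDeriv_approxTaylor, h1.iteratedFDeriv_diag, iteratedFDeriv_diag_zero _ one_lt_two,
    iteratedFDeriv_diag_zero _ (by norm_num), iteratedFDeriv_const_of_ne one_ne_zero]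
  simp

theorem iteratedFDeriv_two_approxTaylor_zero {n : ℕ} {f : Vec n → ℝ} (hf : ContDiff ℝ 2 f)
    (x : Vec n) (T : Tensor 3 n) :
    iteratedFDeriv ℝ 2 (approxTaylor f x T) 0 = iteratedFDeriv ℝ 2 f x := by
  rw [iteratedFDeriv_approxTaylor, (isSymmTensor_iteratedFDeriv_two hf x).iteratedFDeriv_diag,
    iteratedFDeriv_diag_of_lt _ one_lt_two, iteratedFDeriv_diag_zero _ (by norm_num),
    iteratedFDeriv_const_of_ne two_ne_zero]
  simp [smul_smul, Nat.factorial]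

theorem iteratedFDeriv_three_approxTaylor {n : ℕ} (f : Vec n → ℝ) (x : Vec n)
    {T : Tensor 3 n} (hT : IsSymmTensor T) (s : Vec n) :
    iteratedFDeriv ℝ 3 (approxTaylor f x T) s = T := by
  rw [iteratedFDeriv_approxTaylor, hT.iteratedFDeriv_diag,
    iteratedFDeriv_diag_of_lt _ (by norm_num), iteratedFDeriv_diag_of_lt _ (by norm_num),
    iteratedFDeriv_const_of_ne three_ne_zero]
  simp [smul_smul, Nat.factorial]

theorem norm_iteratedFDeriv_le_of_succ {n k : ℕ} {g : Vec n → ℝ} (hg : ContDiff ℝ 3 g)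
    (hk : k < 3) {M r : ℝ} (hM : 0 ≤ M) (h0 : iteratedFDeriv ℝ k g 0 = 0)
    (h : ∀ y, ‖y‖ ≤ r → ‖iteratedFDeriv ℝ (k + 1) g y‖ ≤ M) (y : Vec n) (hy : ‖y‖ ≤ r) :
    ‖iteratedFDeriv ℝ k g y‖ ≤ M * r := by
  have hd : Differentiable ℝ (iteratedFDeriv ℝ k g) :=
    hg.differentiable_iteratedFDeriv (by exact_mod_cast hk)
  have := (convex_closedBall (0 : Vec n) r).norm_image_sub_le_of_norm_fderiv_le
    (f := iteratedFDeriv ℝ k g) (C := M) (x := 0) (y := y)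
    (fun z _ => hd z) (fun z hz => by
      rw [norm_fderiv_iteratedFDeriv]; exact h z (by simpa using hz))
    (by simpa using (norm_nonneg y).trans hy) (by simpa using hy)
  rw [h0, sub_zero, sub_zero] at this
  exact this.trans (by gcongr)

/-- The difference `g` has vanishing derivatives of orders 0, 1, 2 at the origin, and its third
derivative is at most `L‖s‖ + e` on the ball of radius `‖s‖`; the mean value inequality is applied
three times. Factorials are given up, which affects only constants. Symmetry of `T` makes `T` itself
the third derivative of the expansion. -/
theorem approxTaylor_remainder {n : ℕ} {f : Vec n → ℝ} (hf : ContDiff ℝ 3 f) {L : ℝ}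
    (hL : ∀ x y, ‖iteratedFDeriv ℝ 3 f x - iteratedFDeriv ℝ 3 f y‖ ≤ L * ‖x - y‖)
    (hL0 : 0 ≤ L) {x : Vec n} {T : Tensor 3 n} (hT : IsSymmTensor T) {e : ℝ}
    (he : ‖T - iteratedFDeriv ℝ 3 f x‖ ≤ e) (s : Vec n) :
    |f (x + s) - approxTaylor f x T s| ≤ (L * ‖s‖ + e) * ‖s‖ ^ 3 ∧
    ‖iteratedFDeriv ℝ 1 f (x + s) - iteratedFDeriv ℝ 1 (approxTaylor f x T) s‖
      ≤ (L * ‖s‖ + e) * ‖s‖ ^ 2 ∧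
    ‖iteratedFDeriv ℝ 2 f (x + s) - iteratedFDeriv ℝ 2 (approxTaylor f x T) s‖
      ≤ (L * ‖s‖ + e) * ‖s‖ := by
  have he0 : 0 ≤ e := (norm_nonneg _).trans he
  set M := L * ‖s‖ + e
  have hM : 0 ≤ M := by positivity
  have hs := norm_nonneg s
  let g : Vec n → ℝ := (fun y => f (x + y)) - approxTaylor f x T
  have hfx : ContDiff ℝ 3 fun y => f (x + y) := hf.comp (contDiff_const.add contDiff_id)
  have hP : ContDiff ℝ 3 (approxTaylor f x T) := contDiff_approxTaylor f x T
  have hg : ContDiff ℝ 3 g := hfx.sub hP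
  have hD : ∀ k ≤ 3, ∀ y, iteratedFDeriv ℝ k g y =
      iteratedFDeriv ℝ k f (x + y) - iteratedFDeriv ℝ k (approxTaylor f x T) y := by
    intro k hk y
    have hk' : (k : WithTop ℕ∞) ≤ 3 := by exact_mod_cast hk
    rw [iteratedFDeriv_sub_apply (hfx.of_le hk').contDiffAt (hP.of_le hk').contDiffAt,
      iteratedFDeriv_comp_add_left]
  have g3 : ∀ y, ‖y‖ ≤ ‖s‖ → ‖iteratedFDeriv ℝ 3 g y‖ ≤ M := by
    intro y hy
    rw [hD 3 le_rfl, iteratedFDeriv_three_approxTaylor f x hT]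
    have h1 := hL (x + y) x
    rw [add_sub_cancel_left] at h1
    calc ‖iteratedFDeriv ℝ 3 f (x + y) - T‖
        = ‖(iteratedFDeriv ℝ 3 f (x + y) - iteratedFDeriv ℝ 3 f x)
            - (T - iteratedFDeriv ℝ 3 f x)‖ := by congr 1; abel
      _ ≤ L * ‖y‖ + e := (norm_sub_le _ _).trans (add_le_add h1 he)
      _ ≤ M := by simp only [M]; gcongr
  have g2 := norm_iteratedFDeriv_le_of_succ hg (k := 2) (by norm_num) hM
    (by rw [hD 2 (by norm_num), iteratedFDeriv_two_approxTaylor_zero (hf.of_le (by norm_num)),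
          add_zero, sub_self]) g3
  have g1 := norm_iteratedFDeriv_le_of_succ hg (k := 1) (by norm_num) (mul_nonneg hM hs)
    (by rw [hD 1 (by norm_num), iteratedFDeriv_one_approxTaylor_zero, add_zero, sub_self]) g2
  have g0 := norm_iteratedFDeriv_le_of_succ hg (k := 0) (by norm_num)
    (mul_nonneg (mul_nonneg hM hs) hs)
    (by
      ext v
      rw [iteratedFDeriv_zero_apply]
      simp [g, approxTaylor_zero]) g1
  refine ⟨?_, ?_, ?_⟩
  · have := g0 s le_rfl
    rw [norm_iteratedFDeriv_zero, Real.norm_eq_abs] at this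
    calc |f (x + s) - approxTaylor f x T s| ≤ _ := this
      _ = _ := by ring
  · have := g1 s le_rfl
    rw [hD 1 (by norm_num)] at this
    exact this.trans_eq (by ring)
  · have := g2 s le_rfl
    rwa [hD 2 (by norm_num)] at this

/-! ### The leftmost eigenvalue of the Hessian -/

theorem sum_smul_basisVec {n : ℕ} (v : Vec n) : ∑ i, v.ofLp i • basisVec i = v := by
  simpa [basisVec] using (EuclideanSpace.basisFun (Fin n) ℝ).sum_repr v

theorem dotProduct_hessMatrix_mulVec {n : ℕ} (f : Vec n → ℝ) (x v : Vec n) :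
    dotProduct v.ofLp ((hessMatrix f x).mulVec v.ofLp) = iteratedFDeriv ℝ 2 f x fun _ => v := by
  conv_rhs => rw [← sum_smul_basisVec v]
  rw [iteratedFDeriv_two_apply]
  simp only [dotProduct, Matrix.mulVec, hessMatrix, Matrix.of_apply, iteratedFDeriv_two_apply,
    map_sum, map_smul, sum_apply, smul_apply, Matrix.cons_val_zero,
    Matrix.cons_val_one, smul_eq_mul, Finset.mul_sum]
  rw [Finset.sum_comm]
  refine Finset.sum_congr rfl fun i _ => Finset.sum_congr rfl fun j _ => ?_
  ring

theorem isHermitian_hessMatrix {n : ℕ} {f : Vec n → ℝ} (hf : ContDiff ℝ 2 f) (x : Vec n) :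
    (hessMatrix f x).IsHermitian := by
  ext i j
  have := isSymmTensor_iteratedFDeriv_two hf x (Equiv.swap 0 1) ![basisVec i, basisVec j]
  simp only [hessMatrix, Matrix.conjTranspose_apply, Matrix.of_apply, star_trivial]
  rw [← this]
  congr 1
  funext k
  fin_cases k <;> rfl

theorem lambdaMin_mul_sq_le {n : ℕ} {f : Vec n → ℝ} (hf : ContDiff ℝ 2 f) (x v : Vec n) :
    lambdaMin (hessMatrix f x) * ‖v‖ ^ 2 ≤ iteratedFDeriv ℝ 2 f x fun _ => v := by
  have hA := isHermitian_hessMatrix hf x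
  set A := hessMatrix f x
  set c := lambdaMin A with hc
  have hle : ∀ i, c ≤ hA.eigenvalues i := fun i =>
    csInf_le (A.finite_real_spectrum.bddBelow) (hA.eigenvalues_mem_spectrum_real i)
  have hsum : dotProduct v.ofLp (A.mulVec v.ofLp) =
      ∑ i, hA.eigenvalues i * (hA.eigenvectorBasis.repr v i) ^ 2 := by
    have h1 : A.mulVec v.ofLp = (∑ i, (hA.eigenvalues i * hA.eigenvectorBasis.repr v i) •
        hA.eigenvectorBasis i : Vec n).ofLp := by
      conv_lhs => rw [← hA.eigenvectorBasis.sum_repr v]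
      simp only [WithLp.ofLp_sum, WithLp.ofLp_smul, Matrix.mulVec_sum, Matrix.mulVec_smul,
        hA.mulVec_eigenvectorBasis, smul_smul]
      refine Finset.sum_congr rfl fun i _ => ?_
      rw [mul_comm]
    have h2 : ∀ w : Vec n, dotProduct v.ofLp w.ofLp = inner ℝ w v := fun w => by
      simp [PiLp.inner_apply, dotProduct]
    rw [h1, h2, sum_inner]
    refine Finset.sum_congr rfl fun i _ => ?_
    rw [inner_smul_left, hA.eigenvectorBasis.repr_apply_apply]
    simp
    ring
  rw [← dotProduct_hessMatrix_mulVec, hsum, ← hA.eigenvectorBasis.sum_sq_norm_inner_right v,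
    Finset.mul_sum]
  refine Finset.sum_le_sum fun i _ => ?_
  rw [hA.eigenvectorBasis.repr_apply_apply, Real.norm_eq_abs, sq_abs]
  exact mul_le_mul_of_nonneg_right (hle i) (sq_nonneg _)

theorem exists_lambdaMin_eq {n : ℕ} (hn : 1 ≤ n) {f : Vec n → ℝ} (hf : ContDiff ℝ 2 f)
    (x : Vec n) :
    ∃ v : Vec n, ‖v‖ = 1 ∧ (iteratedFDeriv ℝ 2 f x fun _ => v) = lambdaMin (hessMatrix f x) := by
  have hA := isHermitian_hessMatrix hf x
  have hne : (spectrum ℝ (hessMatrix f x)).Nonempty :=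
    ⟨_, hA.eigenvalues_mem_spectrum_real ⟨0, hn⟩⟩
  have hmem := hne.csInf_mem (hessMatrix f x).finite_real_spectrum
  rw [hA.spectrum_real_eq_range_eigenvalues] at hmem
  obtain ⟨i, hi⟩ := hmem
  refine ⟨hA.eigenvectorBasis i, hA.eigenvectorBasis.norm_eq_one i, ?_⟩
  rw [← dotProduct_hessMatrix_mulVec, hA.mulVec_eigenvectorBasis, dotProduct_smul]
  have : dotProduct (hA.eigenvectorBasis i).ofLp (hA.eigenvectorBasis i).ofLp = 1 := by
    have h := real_inner_self_eq_norm_sq (hA.eigenvectorBasis i)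
    rw [hA.eigenvectorBasis.norm_eq_one, PiLp.inner_apply] at h
    simpa [dotProduct, pow_two] using h
  rw [this, smul_eq_mul, mul_one, hi, lambdaMin, hA.spectrum_real_eq_range_eigenvalues]

/-- The quadratic form of `g` is tested on a unit eigenvector for the leftmost eigenvalue of `f`. -/
theorem lambdaMin_le_add {n : ℕ} (hn : 1 ≤ n) {f g : Vec n → ℝ} (hf : ContDiff ℝ 2 f)
    (hg : ContDiff ℝ 2 g) (x y : Vec n) :
    lambdaMin (hessMatrix g y) ≤
      lambdaMin (hessMatrix f x) + ‖iteratedFDeriv ℝ 2 f x - iteratedFDeriv ℝ 2 g y‖ := by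
  obtain ⟨v, hv, he⟩ := exists_lambdaMin_eq hn hf x
  have h1 := lambdaMin_mul_sq_le hg y v
  have h2 := (iteratedFDeriv ℝ 2 f x - iteratedFDeriv ℝ 2 g y).le_opNorm fun _ => v
  simp only [hv, Finset.prod_const_one, mul_one, sub_apply, Real.norm_eq_abs, one_pow] at h1 h2
  have := (abs_le.1 h2).1
  linarith

theorem norm_gradient_eq {n : ℕ} (f : Vec n → ℝ) (x : Vec n) :
    ‖gradient f x‖ = ‖iteratedFDeriv ℝ 1 f x‖ := by
  rw [gradient, LinearIsometryEquiv.norm_map, norm_iteratedFDeriv_one]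

/-! ### The Frobenius inner product and the PSB update -/

/-- The Frobenius inner product of two tensors. -/
noncomputable def frobInner {p n : ℕ} (A B : Tensor p n) : ℝ :=
  ∑ i : Fin p → Fin n, (A fun j => basisVec (i j)) * B fun j => basisVec (i j)

theorem apply_eq_sum_basisVec {p n : ℕ} (A : Tensor p n) (v : Fin p → Vec n) :
    A v = ∑ r : Fin p → Fin n, (∏ j, (v j).ofLp (r j)) * A fun j => basisVec (r j) := by
  conv_lhs => rw [← funext fun j => sum_smul_basisVec (v j)]
  rw [A.map_sum]
  refine Finset.sum_congr rfl fun r _ => ?_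
  rw [A.map_smul_univ (fun j => (v j).ofLp (r j)) fun j => basisVec (r j), smul_eq_mul]

theorem tensor_ext_basisVec {p n : ℕ} {A B : Tensor p n}
    (h : ∀ i : Fin p → Fin n, (A fun j => basisVec (i j)) = B fun j => basisVec (i j)) :
    A = B := by
  ext v
  rw [apply_eq_sum_basisVec, apply_eq_sum_basisVec B]
  simp only [h]

theorem frobInner_compContinuousLinearMap {p n : ℕ} (A B : Tensor p n) (P : Vec n →L[ℝ] Vec n)
    (hP : ∀ u v, inner ℝ (P u) v = inner ℝ u (P v)) :
    frobInner (A.compContinuousLinearMap fun _ => P) B =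
      frobInner A (B.compContinuousLinearMap fun _ => P) := by
  have hsymm : ∀ i j, (P (basisVec i)).ofLp j = (P (basisVec j)).ofLp i := fun i j => by
    have := hP (basisVec i) (basisVec j)
    simpa [basisVec, EuclideanSpace.inner_single_left, EuclideanSpace.inner_single_right]
      using this
  simp only [frobInner]
  conv_lhs =>
    enter [2, i]
    rw [A.compContinuousLinearMap_apply, apply_eq_sum_basisVec, Finset.sum_mul]
  conv_rhs =>
    enter [2, i]
    rw [B.compContinuousLinearMap_apply, apply_eq_sum_basisVec B, Finset.mul_sum]
  rw [Finset.sum_comm]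
  refine Finset.sum_congr rfl fun i _ => Finset.sum_congr rfl fun r _ => ?_
  simp only [hsymm (r _) (i _)]
  ring

theorem frobNorm_le_iff {p n : ℕ} {A B : Tensor p n} :
    frobNorm A ≤ frobNorm B ↔ frobInner A A ≤ frobInner B B := by
  simp only [frobNorm, frobInner, ← pow_two]
  exact Real.sqrt_le_sqrt_iff (Finset.sum_nonneg fun _ _ => sq_nonneg _)

theorem IsSymmTensor.sub {p n : ℕ} {A B : Tensor p n} (hA : IsSymmTensor A)
    (hB : IsSymmTensor B) : IsSymmTensor (A - B) := fun π v => by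
  rw [sub_apply, sub_apply, hA π v, hB π v]

theorem IsSymmTensor.add {p n : ℕ} {A B : Tensor p n} (hA : IsSymmTensor A)
    (hB : IsSymmTensor B) : IsSymmTensor (A + B) := fun π v => by
  rw [add_apply, add_apply, hA π v, hB π v]

theorem IsSymmTensor.comp {p n : ℕ} {A : Tensor p n} (hA : IsSymmTensor A)
    (P : Vec n →L[ℝ] Vec n) : IsSymmTensor (A.compContinuousLinearMap fun _ => P) :=
  fun π v => hA π fun j => P (v j)

theorem IsSymmTensor.apply_eq_zero {p n : ℕ} {A : Tensor (p + 1) n} (hA : IsSymmTensor A)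
    {s : Vec n} (hs : A.curryLeft s = 0) {v : Fin (p + 1) → Vec n} {a : Fin (p + 1)}
    (hv : v a = s) : A v = 0 := by
  rw [← hA (Equiv.swap 0 a) v, ← Fin.cons_self_tail (fun i => v (Equiv.swap 0 a i))]
  simp only [Equiv.swap_apply_left, hv]
  exact congrArg (fun l : Tensor p n => l _) hs

/-- By symmetry `A` vanishes as soon as one argument is a multiple of `s`, so `v` can be replaced by
`P v` one slot at a time. -/
theorem IsSymmTensor.comp_eq_self {p n : ℕ} {A : Tensor (p + 1) n} (hA : IsSymmTensor A)
    {s : Vec n} (hs : A.curryLeft s = 0) {P : Vec n →L[ℝ] Vec n}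
    (hP : ∀ v, ∃ c : ℝ, v - P v = c • s) : A.compContinuousLinearMap (fun _ => P) = A := by
  ext v
  have key : ∀ S : Finset (Fin (p + 1)), A (fun j => if j ∈ S then P (v j) else v j) = A v := by
    intro S
    induction S using Finset.induction_on with
    | empty => simp
    | insert a S ha ih =>
      obtain ⟨c, hc⟩ := hP (v a)
      set w : Fin (p + 1) → Vec n := fun j => if j ∈ S then P (v j) else v j
      have hw : (fun j => if j ∈ insert a S then P (v j) else v j) =
          Function.update w a (v a - c • s) := by
        funext j
        by_cases hj : j = a
        · subst hj
          simp [← hc]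
        · simp [hj, w]
      have hwa : Function.update w a (v a) = w := by
        rw [show v a = w a by simp [w, ha], Function.update_eq_self]
      rw [hw, A.map_update_sub, A.map_update_smul, hwa, ih,
        hA.apply_eq_zero hs (Function.update_self a s w), smul_zero, sub_zero]
  simpa using key Finset.univ

/-- With `E = Tprev - H`, the minimizer is `H + E ∘ P`, where `P` projects onto the orthogonal
complement of `s`. Let `D` be the deviation of `T` from this competitor. It is annihilated by `s`,
so `D = D ∘ P`, while `(E ∘ P - E) ∘ P = 0`; since `P` is self-adjoint, the two are
Frobenius-orthogonal, and Pythagoras with minimality gives `D = 0`. The bound then follows from `‖P‖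
≤ 1`, in the operator norm. -/
theorem norm_sub_le_of_isPSBUpdate {n : ℕ} {Tprev T H : Tensor 3 n} {s : Vec n} {Y : Tensor 2 n}
    (hprev : IsSymmTensor Tprev) (hH : H ∈ secantSet s Y) (hT : IsPSBUpdate Tprev s Y T) :
    ‖T - H‖ ≤ ‖Tprev - H‖ := by
  obtain ⟨hTs, hmin⟩ := hT
  set K : Submodule ℝ (Vec n) := (Submodule.span ℝ {s})ᗮ
  set P : Vec n →L[ℝ] Vec n := K.starProjection
  have hPsymm : ∀ u v, inner ℝ (P u) v = inner ℝ u (P v) := fun u v =>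
    K.starProjection_isSymmetric u v
  have hPs : P s = 0 := by
    rw [Submodule.starProjection_apply_eq_zero_iff]
    rw [Submodule.orthogonal_orthogonal]
    exact Submodule.mem_span_singleton_self s
  have hPP : ∀ v, P (P v) = P v := fun v =>
    Submodule.starProjection_eq_self_iff.2 (Submodule.starProjection_apply_mem K v)
  have hPc : ∀ v, ∃ c : ℝ, v - P v = c • s := fun v => by
    have := Submodule.sub_starProjection_mem_orthogonal (K := K) v
    rw [Submodule.orthogonal_orthogonal, Submodule.mem_span_singleton] at this
    obtain ⟨c, hc⟩ := this
    exact ⟨c, hc.symm⟩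
  set E := Tprev - H
  set E' := E.compContinuousLinearMap fun _ => P
  have hE : IsSymmTensor E := hprev.sub hH.1
  have hE' : IsSymmTensor E' := hE.comp P
  have hE's : E'.curryLeft s = 0 := by
    ext v
    exact E.map_coord_zero 0 hPs
  have hmem : H + E' ∈ secantSet s Y := by
    refine ⟨hH.1.add hE', ?_⟩
    have : (H + E').curryLeft s = H.curryLeft s + E'.curryLeft s := rfl
    rw [this, hH.2, hE's, add_zero]
  have hle := frobNorm_le_iff.1 (hmin _ hmem)
  set D := T - H - E'
  have hDs : D.curryLeft s = 0 := by
    have : D.curryLeft s = T.curryLeft s - H.curryLeft s - E'.curryLeft s := rfl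
    rw [this, hTs.2, hH.2, hE's, sub_self, sub_zero]
  have hD : D.compContinuousLinearMap (fun _ => P) = D :=
    ((hTs.1.sub hH.1).sub hE').comp_eq_self hDs hPc
  have horth : frobInner D (E' - E) = 0 := by
    rw [← hD, frobInner_compContinuousLinearMap _ _ _ hPsymm]
    have : (E' - E).compContinuousLinearMap (fun _ => P) = 0 := by
      ext v
      simp [E', hPP]
    simp [this, frobInner]
  have hexp : frobInner (T - Tprev) (T - Tprev) =
      frobInner D D + 2 * frobInner D (E' - E) + frobInner (E' - E) (E' - E) := by
    have : T - Tprev = D + (E' - E) := by simp only [D, E]; abel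
    rw [this]
    simp only [frobInner, Finset.mul_sum, ← Finset.sum_add_distrib, add_apply]
    exact Finset.sum_congr rfl fun i _ => by ring
  have h2 : H + E' - Tprev = E' - E := by simp only [E]; abel
  rw [hexp, horth, h2] at hle
  have hD0 : frobInner D D = 0 :=
    le_antisymm (by linarith) (Finset.sum_nonneg fun _ _ => mul_self_nonneg _)
  have hDz : D = 0 := by
    refine tensor_ext_basisVec fun i => ?_
    have := (Finset.sum_eq_zero_iff_of_nonneg fun _ _ => mul_self_nonneg _).1 hD0 i
      (Finset.mem_univ i)
    simpa using this
  have hTE : T - H = E' := sub_eq_zero.1 hDz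
  rw [hTE]
  calc ‖E'‖ ≤ ‖E‖ * ∏ _j : Fin 3, ‖P‖ := E.norm_compContinuousLinearMap_le _
    _ ≤ ‖E‖ * 1 := by
        gcongr
        exact Finset.prod_le_one (fun _ _ => norm_nonneg _)
          fun _ _ => Submodule.starProjection_norm_le K
    _ = ‖E‖ := mul_one _

/-- The witness is the mean of the third derivative over the segment from `x` to `x + s`; the secant
equation is the fundamental theorem of calculus. The bound at `y` serves for both endpoints. -/
theorem exists_mem_secantSet {n : ℕ} {f : Vec n → ℝ} (hf : ContDiff ℝ 3 f) {L : ℝ}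
    (hL : ∀ x y, ‖iteratedFDeriv ℝ 3 f x - iteratedFDeriv ℝ 3 f y‖ ≤ L * ‖x - y‖)
    (hL0 : 0 ≤ L) (x s : Vec n) :
    ∃ H ∈ secantSet s (iteratedFDeriv ℝ 2 f (x + s) - iteratedFDeriv ℝ 2 f x),
      ∀ y, (∀ t ∈ Set.Icc (0 : ℝ) 1, ‖x + t • s - y‖ ≤ ‖s‖) →
        ‖H - iteratedFDeriv ℝ 3 f y‖ ≤ L * ‖s‖ := by
  set F : ℝ → Tensor 3 n := fun t => iteratedFDeriv ℝ 3 f (x + t • s)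
  have hF : Continuous F := (hf.continuous_iteratedFDeriv le_rfl).comp (by fun_prop)
  have hint := hF.intervalIntegrable (μ := MeasureTheory.volume) 0 1
  set H : Tensor 3 n := ∫ t in (0 : ℝ)..1, F t
  have happ : ∀ v, H v = ∫ t in (0 : ℝ)..1, F t v := fun v =>
    ((ContinuousMultilinearMap.apply ℝ (fun _ : Fin 3 => Vec n) ℝ v).intervalIntegral_comp_comm
      hint).symm
  refine ⟨H, ⟨fun π v => ?_, ?_⟩, fun y hy => ?_⟩
  · rw [happ, happ]
    simp only [F, isSymmTensor_iteratedFDeriv_three hf _ π v]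
  · ext v
    have hderiv : ∀ t : ℝ, HasDerivAt (fun t : ℝ => iteratedFDeriv ℝ 2 f (x + t • s) v)
        (F t (Fin.cons s v)) t := by
      intro t
      have h1 : HasFDerivAt (iteratedFDeriv ℝ 2 f)
          (fderiv ℝ (iteratedFDeriv ℝ 2 f) (x + t • s)) (x + t • s) :=
        (hf.differentiable_iteratedFDeriv (by norm_num) _).hasFDerivAt
      have h2 : HasDerivAt (fun t : ℝ => x + t • s) s t := by
        simpa using ((hasDerivAt_id t).smul_const s).const_add x
      have h3 := h1.comp_hasDerivAt t h2
      exact (ContinuousMultilinearMap.apply ℝ (fun _ : Fin 2 => Vec n) ℝ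
        v).hasFDerivAt.comp_hasDerivAt t h3
    have := intervalIntegral.integral_eq_sub_of_hasDerivAt (a := 0) (b := 1)
      (fun t _ => hderiv t)
      (((ContinuousMultilinearMap.apply ℝ (fun _ : Fin 3 => Vec n) ℝ
        (Fin.cons s v)).continuous.comp hF).intervalIntegrable 0 1)
    simpa [← happ] using this
  · have hsub : H - iteratedFDeriv ℝ 3 f y = ∫ t in (0 : ℝ)..1, (F t - iteratedFDeriv ℝ 3 f y) := by
      rw [intervalIntegral.integral_sub hint intervalIntegrable_const]
      simp [H]
    rw [hsub]
    refine (intervalIntegral.norm_integral_le_of_norm_le_const (C := L * ‖s‖) fun t ht => ?_).trans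
      (by simp)
    rw [Set.uIoc_of_le zero_le_one] at ht
    exact (hL _ _).trans (mul_le_mul_of_nonneg_left (hy t ⟨ht.1.le, ht.2⟩) hL0)

theorem norm_psb_error_le {n : ℕ} {f : Vec n → ℝ} (hf : ContDiff ℝ 3 f) {L : ℝ}
    (hL : ∀ x y, ‖iteratedFDeriv ℝ 3 f x - iteratedFDeriv ℝ 3 f y‖ ≤ L * ‖x - y‖)
    (hL0 : 0 ≤ L) {x s : Vec n} {Tprev T : Tensor 3 n} (hprev : IsSymmTensor Tprev)
    (hT : IsPSBUpdate Tprev s (iteratedFDeriv ℝ 2 f (x + s) - iteratedFDeriv ℝ 2 f x) T) :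
    ‖T - iteratedFDeriv ℝ 3 f (x + s)‖ ≤
      ‖Tprev - iteratedFDeriv ℝ 3 f x‖ + 2 * L * ‖s‖ := by
  obtain ⟨H, hH, hHy⟩ := exists_mem_secantSet hf hL hL0 x s
  have h1 := norm_sub_le_of_isPSBUpdate hprev hH hT
  have h2 := hHy x fun t ht => by
    rw [add_sub_cancel_left, norm_smul, Real.norm_of_nonneg ht.1]
    exact mul_le_of_le_one_left (norm_nonneg s) ht.2
  have h3 := hHy (x + s) fun t ht => by
    rw [add_sub_add_left_eq_sub, show t • s - s = (t - 1) • s by rw [sub_smul, one_smul],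
      norm_smul, Real.norm_eq_abs,
      abs_of_nonpos (by linarith [ht.2])]
    exact mul_le_of_le_one_left (norm_nonneg s) (by linarith [ht.1])
  have h4 := norm_sub_le_norm_sub_add_norm_sub T H (iteratedFDeriv ℝ 3 f (x + s))
  have h5 := norm_sub_le_norm_sub_add_norm_sub Tprev (iteratedFDeriv ℝ 3 f x) H
  rw [norm_sub_rev (iteratedFDeriv ℝ 3 f x) H] at h5
  linarith

/-! ### The finite-difference tensor -/

theorem isSymmTensor_symProj {p n : ℕ} (T : Tensor p n) : IsSymmTensor (symProj T) := by
  intro π v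
  rw [symProj_apply, symProj_apply]
  congr 1
  exact Fintype.sum_equiv (Equiv.mulLeft π) _ _ fun τ => rfl

theorem IsSymmTensor.symProj_eq {p n : ℕ} {T : Tensor p n} (hT : IsSymmTensor T) :
    symProj T = T := by
  ext v
  rw [symProj_apply]
  have : (Nat.factorial p : ℝ) ≠ 0 := by positivity
  simp [hT _ v, Fintype.card_perm, this]

theorem norm_symProj_le {p n : ℕ} (T : Tensor p n) : ‖symProj T‖ ≤ ‖T‖ := by
  have hp : (Nat.factorial p : ℝ) ≠ 0 := by positivity
  rw [symProj, norm_smul, norm_inv, Real.norm_natCast]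
  calc _ ≤ (Nat.factorial p : ℝ)⁻¹ * ∑ _π : Equiv.Perm (Fin p), ‖T‖ := by
        gcongr
        refine (norm_sum_le _ _).trans (Finset.sum_le_sum fun π _ => ?_)
        exact (ContinuousMultilinearMap.norm_domDomCongr ℝ (Vec n) ℝ π T).le
    _ = ‖T‖ := by
        simp [Fintype.card_perm, hp]

theorem symProj_sub {p n : ℕ} (A B : Tensor p n) : symProj (A - B) = symProj A - symProj B := by
  ext v
  simp only [symProj_apply, sub_apply, Finset.sum_sub_distrib, mul_sub]

theorem sum_abs_le_sqrt_mul_norm {n : ℕ} (v : Vec n) :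
    ∑ i, |v.ofLp i| ≤ Real.sqrt n * ‖v‖ := by
  have h := sq_sum_le_card_mul_sum_sq (s := (Finset.univ : Finset (Fin n)))
    (f := fun i => |v.ofLp i|)
  rw [EuclideanSpace.norm_eq, ← Real.sqrt_mul (Nat.cast_nonneg n)]
  refine Real.le_sqrt_of_sq_le ?_
  simpa using h

/-- Only the last slot is expanded in the basis. Each difference quotient is a mean of the third
derivative along `h e_i`, with error at most `L h`, and Cauchy–Schwarz on the coordinates costs
`√n`, which the stepsize compensates. -/
theorem norm_fdTensor_sub_le {n : ℕ} {f : Vec n → ℝ} (hf : ContDiff ℝ 3 f) {L : ℝ}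
    (hL : ∀ x y, ‖iteratedFDeriv ℝ 3 f x - iteratedFDeriv ℝ 3 f y‖ ≤ L * ‖x - y‖)
    (hL0 : 0 ≤ L) (x : Vec n) {h : ℝ} (hh : 0 < h) :
    ‖fdTensor f x h - iteratedFDeriv ℝ 3 f x‖ ≤ L * (h * Real.sqrt n) := by
  refine ContinuousMultilinearMap.opNorm_le_bound (by positivity) fun v => ?_
  set u : Fin 2 → Vec n := fun i => v i.castSucc
  set w : Vec n := v (Fin.last 2)
  have hexp : (fdTensor f x h - iteratedFDeriv ℝ 3 f x) v =
      ∑ i, (h⁻¹ * (iteratedFDeriv ℝ 2 f (x + h • basisVec i) u - iteratedFDeriv ℝ 2 f x u) -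
        iteratedFDeriv ℝ 3 f x (Fin.cons (basisVec i) u)) * w.ofLp i := by
    have h3 : iteratedFDeriv ℝ 3 f x v =
        ∑ i, iteratedFDeriv ℝ 3 f x (Fin.cons (basisVec i) u) * w.ofLp i := by
      -- `outer` puts `e_i` in the last slot, whereas differentiating the Hessian puts the new
      -- direction in the first.
      have hrot : iteratedFDeriv ℝ 3 f x v = iteratedFDeriv ℝ 3 f x (Fin.cons w u) := by
        rw [← isSymmTensor_iteratedFDeriv_three hf x (finRotate 3).symm v]
        congr 1
        funext j
        fin_cases j <;> rfl
      have hc : ∀ z, iteratedFDeriv ℝ 3 f x (Fin.cons z u) =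
          (iteratedFDeriv ℝ 3 f x).curryLeft z u := fun z => rfl
      rw [hrot]
      simp only [hc]
      conv_lhs => rw [← sum_smul_basisVec w]
      simp [map_sum, sum_apply, mul_comm]
    rw [sub_apply, h3, fdTensor, sum_apply, ← Finset.sum_sub_distrib]
    refine Finset.sum_congr rfl fun i _ => ?_
    rw [outer_apply]
    simp [basisVec, EuclideanSpace.inner_single_left, u, w]
    ring
  have hterm : ∀ i, |h⁻¹ * (iteratedFDeriv ℝ 2 f (x + h • basisVec i) u -
      iteratedFDeriv ℝ 2 f x u) - iteratedFDeriv ℝ 3 f x (Fin.cons (basisVec i) u)| ≤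
      L * h * ∏ j, ‖u j‖ := by
    intro i
    have hb : ‖(basisVec i : Vec n)‖ = 1 := by simp [basisVec]
    obtain ⟨H, hH, hHy⟩ := exists_mem_secantSet hf hL hL0 x (h • basisVec i)
    have hn : ‖h • (basisVec i : Vec n)‖ = h := by
      rw [norm_smul, hb, mul_one, Real.norm_of_nonneg hh.le]
    have h1 := hHy x fun t ht => by
      rw [add_sub_cancel_left, norm_smul, Real.norm_of_nonneg ht.1]
      exact mul_le_of_le_one_left (norm_nonneg _) ht.2
    have h2 : iteratedFDeriv ℝ 2 f (x + h • basisVec i) u - iteratedFDeriv ℝ 2 f x u =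
        h * H (Fin.cons (basisVec i) u) := by
      have := congrArg (fun A : Tensor 2 n => A u) hH.2
      rw [← sub_apply, ← this]
      change H.curryLeft (h • basisVec i) u = h * H.curryLeft (basisVec i) u
      rw [map_smul]; rfl
    rw [h2, inv_mul_cancel_left₀ hh.ne', ← sub_apply, ← Real.norm_eq_abs]
    refine ((H - iteratedFDeriv ℝ 3 f x).norm_map_cons_le _ _).trans ?_
    rw [hb, mul_one]
    rw [hn] at h1
    exact mul_le_mul_of_nonneg_right h1 (Finset.prod_nonneg fun _ _ => norm_nonneg _)
  rw [hexp, Real.norm_eq_abs]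
  calc _ ≤ ∑ i, (L * h * ∏ j, ‖u j‖) * |w.ofLp i| := by
        refine (Finset.abs_sum_le_sum_abs _ _).trans (Finset.sum_le_sum fun i _ => ?_)
        rw [abs_mul]
        exact mul_le_mul_of_nonneg_right (hterm i) (abs_nonneg _)
    _ ≤ (L * h * ∏ j, ‖u j‖) * (Real.sqrt n * ‖w‖) := by
        rw [← Finset.mul_sum]
        gcongr
        exact sum_abs_le_sqrt_mul_norm w
    _ = L * (h * Real.sqrt n) * ∏ j, ‖v j‖ := by
        rw [Fin.prod_univ_castSucc (fun j => ‖v j‖)]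
        ring

theorem norm_symProj_fdTensor_sub_le {n : ℕ} {f : Vec n → ℝ} (hf : ContDiff ℝ 3 f) {L : ℝ}
    (hL : ∀ x y, ‖iteratedFDeriv ℝ 3 f x - iteratedFDeriv ℝ 3 f y‖ ≤ L * ‖x - y‖)
    (hL0 : 0 ≤ L) (x : Vec n) {h : ℝ} (hh : 0 < h) :
    ‖symProj (fdTensor f x h) - iteratedFDeriv ℝ 3 f x‖ ≤ L * (h * Real.sqrt n) := by
  rw [← (isSymmTensor_iteratedFDeriv_three hf x).symProj_eq, ← symProj_sub]
  exact (norm_symProj_le _).trans (norm_fdTensor_sub_le hf hL hL0 x hh)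

/-! ### Sums of past step lengths -/

/-- The length `a (k - i)` of an earlier step, with the value `1` before the first step. -/
noncomputable def pastLength (a : ℕ → ℝ) (k i : ℕ) : ℝ := if i ≤ k then a (k - i) else 1

theorem pastLength_zero (a : ℕ → ℝ) (k : ℕ) : pastLength a k 0 = a k := by
  simp [pastLength]

theorem pastLength_succ_succ (a : ℕ → ℝ) (k i : ℕ) :
    pastLength a (k + 1) (i + 1) = pastLength a k i := by
  simp [pastLength]

theorem pastLength_nonneg {a : ℕ → ℝ} (ha : ∀ k, 0 ≤ a k) (k i : ℕ) : 0 ≤ pastLength a k i := by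
  unfold pastLength; split_ifs <;> simp [ha]

/-- The sum of the lengths of the `p` steps before step `k`. -/
noncomputable def pastSum (a : ℕ → ℝ) (p k : ℕ) : ℝ :=
  ∑ i ∈ Finset.range p, pastLength a k (i + 1)

theorem pastSum_nonneg {a : ℕ → ℝ} (ha : ∀ k, 0 ≤ a k) (p k : ℕ) : 0 ≤ pastSum a p k :=
  Finset.sum_nonneg fun _ _ => pastLength_nonneg ha _ _

theorem pastSum_mono {a : ℕ → ℝ} (ha : ∀ k, 0 ≤ a k) {p q : ℕ} (h : p ≤ q) (k : ℕ) :
    pastSum a p k ≤ pastSum a q k :=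
  Finset.sum_le_sum_of_subset_of_nonneg (Finset.range_mono h)
    fun _ _ _ => pastLength_nonneg ha _ _

theorem pastSum_succ (a : ℕ → ℝ) (p k : ℕ) :
    pastSum a (p + 1) (k + 1) = a k + pastSum a p k := by
  rw [pastSum, Finset.sum_range_succ', add_comm]
  simp only [pastLength_succ_succ, pastLength_zero, pastSum]

theorem add_pastSum (a : ℕ → ℝ) (p k : ℕ) :
    a k + pastSum a p k = ∑ i ∈ Finset.range (p + 1), pastLength a k i := by
  rw [Finset.sum_range_succ', add_comm, pastLength_zero, pastSum]

theorem pastSum_le_of_le {a : ℕ → ℝ} {A : ℝ} (hA : 1 ≤ A) {k : ℕ} (h : ∀ j < k, a j ≤ A)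
    (p : ℕ) : pastSum a p k ≤ p * A := by
  have : ∀ i ∈ Finset.range p, pastLength a k (i + 1) ≤ A := fun i _ => by
    unfold pastLength
    split_ifs with hi
    · exact h _ (by omega)
    · exact hA
  simpa [pastSum] using Finset.sum_le_card_nsmul _ _ _ this

/-- Each shift of the index brings in one conventional value `1` and drops a nonnegative last term.
-/
theorem sum_pastLength_pow_le {a : ℕ → ℝ} (ha : ∀ k, 0 ≤ a k) (N i : ℕ) :
    ∑ k ∈ Finset.range N, pastLength a k i ^ 4 ≤ ∑ k ∈ Finset.range N, a k ^ 4 + i := by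
  induction i generalizing N with
  | zero => simp [pastLength_zero]
  | succ i ih =>
    cases N with
    | zero => simp; positivity
    | succ N =>
      rw [Finset.sum_range_succ']
      simp only [pastLength_succ_succ]
      have h1 := ih N
      have h2 : ∑ k ∈ Finset.range N, a k ^ 4 ≤ ∑ k ∈ Finset.range (N + 1), a k ^ 4 := by
        rw [Finset.sum_range_succ]
        have := pow_nonneg (ha N) 4
        linarith
      have h3 : pastLength a 0 (i + 1) ^ 4 = 1 := by simp [pastLength]
      push_cast
      linarith

/-- The power mean inequality gives three factors `p + 1`; the number of lags gives the fourth. -/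
theorem sum_add_pastSum_pow_le {a : ℕ → ℝ} (ha : ∀ k, 0 ≤ a k) (p N : ℕ) :
    ∑ k ∈ Finset.range N, (a k + pastSum a p k) ^ 4 ≤
      (p + 1 : ℝ) ^ 4 * (∑ k ∈ Finset.range N, a k ^ 4 + p) := by
  have h1 : ∀ k, (a k + pastSum a p k) ^ 4 ≤
      (p + 1 : ℝ) ^ 3 * ∑ i ∈ Finset.range (p + 1), pastLength a k i ^ 4 := fun k => by
    rw [add_pastSum]
    simpa using pow_sum_le_card_mul_sum_pow (s := Finset.range (p + 1))
      (f := pastLength a k) (fun i _ => pastLength_nonneg ha k i) 3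
  calc _ ≤ ∑ k ∈ Finset.range N,
        (p + 1 : ℝ) ^ 3 * ∑ i ∈ Finset.range (p + 1), pastLength a k i ^ 4 :=
        Finset.sum_le_sum fun k _ => h1 k
    _ = (p + 1 : ℝ) ^ 3 *
        ∑ i ∈ Finset.range (p + 1), ∑ k ∈ Finset.range N, pastLength a k i ^ 4 := by
        rw [← Finset.mul_sum, Finset.sum_comm]
    _ ≤ (p + 1 : ℝ) ^ 3 *
        ∑ _i ∈ Finset.range (p + 1), (∑ k ∈ Finset.range N, a k ^ 4 + p) := by
        gcongr with i hi
        refine (sum_pastLength_pow_le ha N i).trans ?_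
        gcongr
        exact Nat.lt_succ_iff.1 (Finset.mem_range.1 hi)
    _ = _ := by
        simp
        ring

/-! ### Complexity of the scalar recursion -/

/-- The scalar inequalities satisfied in iterations `0, …, N` by the step lengths `a`, the
regularization parameters `σ`, the function values `F`, the gradient norms `g` and the negative
curvatures `c` of a run. -/
structure IsStepSequence (p : ℕ) (σ₀ θ D κ Δ G B : ℝ) (a σ F g c : ℕ → ℝ) (N : ℕ) : Prop where
  nonneg : ∀ k, 0 ≤ a k
  σ_zero : σ 0 = σ₀
  σ_succ : ∀ k, σ (k + 1) = σ k + σ k * a k ^ 4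
  gap : ∀ k, F 0 - F k ≤ Δ
  grad_zero : g 0 ≤ G
  curv_zero : c 0 ≤ B
  descent : ∀ k ≤ N, F (k + 1) - F k + σ k / 24 * a k ^ 4 ≤ D * (a k + pastSum a p k) ^ 4
  step : ∀ k ≤ N, σ k / 24 * a k ^ 4 ≤
    g k * a k + c k * a k ^ 2 + (κ + D * pastSum a p k) * a k ^ 3
  grad : ∀ k ≤ N, g (k + 1) ≤ (θ * σ k + D) * (a k + pastSum a p k) ^ 3
  curv : ∀ k ≤ N, c (k + 1) ≤ (θ * σ k + D) * (a k + pastSum a p k) ^ 2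

section

variable {p : ℕ} {σ₀ θ D κ Δ G B : ℝ} {a σ F g c : ℕ → ℝ} {N : ℕ}

theorem IsStepSequence.le_σ (h : IsStepSequence p σ₀ θ D κ Δ G B a σ F g c N) (hσ₀ : 0 < σ₀)
    (k : ℕ) : σ₀ ≤ σ k := by
  induction k with
  | zero => exact h.σ_zero.ge
  | succ k ih =>
    rw [h.σ_succ]
    have := mul_nonneg (hσ₀.le.trans ih) (pow_nonneg (h.nonneg k) 4)
    linarith

theorem IsStepSequence.σ_mono (h : IsStepSequence p σ₀ θ D κ Δ G B a σ F g c N) (hσ₀ : 0 < σ₀) :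
    Monotone σ := by
  refine monotone_nat_of_le_succ fun k => ?_
  rw [h.σ_succ]
  have := mul_nonneg (hσ₀.le.trans (h.le_σ hσ₀ k)) (pow_nonneg (h.nonneg k) 4)
  linarith

theorem IsStepSequence.σ_eq (h : IsStepSequence p σ₀ θ D κ Δ G B a σ F g c N) (k : ℕ) :
    σ k = σ₀ + ∑ j ∈ Finset.range k, σ j * a j ^ 4 := by
  induction k with
  | zero => simp [h.σ_zero]
  | succ k ih => rw [h.σ_succ, Finset.sum_range_succ, ← add_assoc, ← ih]

theorem IsStepSequence.sum_pow_le (h : IsStepSequence p σ₀ θ D κ Δ G B a σ F g c N)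
    (hσ₀ : 0 < σ₀) (k : ℕ) : ∑ j ∈ Finset.range k, a j ^ 4 ≤ σ k / σ₀ := by
  rw [le_div_iff₀ hσ₀, h.σ_eq k, Finset.sum_mul]
  have : ∑ j ∈ Finset.range k, a j ^ 4 * σ₀ ≤ ∑ j ∈ Finset.range k, σ j * a j ^ 4 :=
    Finset.sum_le_sum fun j _ => by
      rw [mul_comm]
      exact mul_le_mul_of_nonneg_right (h.le_σ hσ₀ j) (pow_nonneg (h.nonneg j) 4)
  linarith

end

theorem le_max_of_quartic_le {r x y z s : ℝ} (hx : 0 ≤ x) (hy : 0 ≤ y)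
    (hs : 0 < s) (h : s * r ^ 4 ≤ x * r + y * r ^ 2 + z * r ^ 3) :
    r ≤ max 1 ((x + y + z) / s) := by
  rcases le_or_gt r 1 with h1 | h1
  · exact h1.trans (le_max_left _ _)
  · refine le_trans ?_ (le_max_right _ _)
    rw [le_div_iff₀ hs]
    have h3 : 0 < r ^ 3 := by positivity
    have hr1 : r ≤ r ^ 3 := le_self_pow₀ h1.le (by norm_num)
    have hr2 : r ^ 2 ≤ r ^ 3 := pow_le_pow_right₀ h1.le (by norm_num)
    have : r ^ 3 * (r * s) ≤ r ^ 3 * (x + y + z) := by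
      nlinarith [mul_le_mul_of_nonneg_left hr1 hx, mul_le_mul_of_nonneg_left hr2 hy]
    exact le_of_mul_le_mul_left this h3

/-- This controls the one step by which `σ` may jump beyond `S`. Steps before it are bounded since
their increments of `σ` fit below `S`; they bound the gradient, the curvature and the tensor at the
current point, and then the decrease of the model bounds the step. -/
theorem exists_step_bound (p : ℕ) {σ₀ θ D κ G B : ℝ} (Δ : ℝ) (hσ₀ : 0 < σ₀) (hθ : 0 ≤ θ)
    (hD : 0 ≤ D) (hG : 0 ≤ G) (hB : 0 ≤ B) {S : ℝ} (hS : σ₀ ≤ S) :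
    ∃ A : ℝ, ∀ (a σ F g c : ℕ → ℝ) (N : ℕ), IsStepSequence p σ₀ θ D κ Δ G B a σ F g c N →
      ∀ k ≤ N, σ k ≤ S → a k ≤ A := by
  -- `A₀` dominates the fourth root of `S / σ₀` and also the conventional length `1`.
  set A₀ : ℝ := 1 + S / σ₀ with hA₀
  have hS0 : 0 < S := hσ₀.trans_le hS
  have hA1 : 1 ≤ A₀ := by rw [hA₀]; linarith [div_pos hS0 hσ₀]
  set X : ℝ := G + (θ * S + D) * ((p + 1) * A₀) ^ 3 with hX
  set Y : ℝ := B + (θ * S + D) * ((p + 1) * A₀) ^ 2 with hY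
  set Z : ℝ := κ + D * (p * A₀) with hZ
  have hX0 : 0 ≤ (θ * S + D) * ((p + 1) * A₀) ^ 3 := by positivity
  have hY0 : 0 ≤ (θ * S + D) * ((p + 1) * A₀) ^ 2 := by positivity
  refine ⟨max 1 ((X + Y + Z) / (σ₀ / 24)), fun a σ F g c N h k hk hkS => ?_⟩
  have ha : ∀ j < k, a j ≤ A₀ := by
    intro j hj
    have h1 : σ₀ * a j ^ 4 ≤ S := by
      have h2 := (h.σ_mono hσ₀ (Nat.succ_le_of_lt hj)).trans hkS
      rw [Nat.succ_eq_add_one, h.σ_succ] at h2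
      have h3 := h.le_σ hσ₀ j
      have := mul_le_mul_of_nonneg_right h3 (pow_nonneg (h.nonneg j) 4)
      linarith
    have h2 : a j ^ 4 ≤ S / σ₀ := by rw [le_div_iff₀ hσ₀]; linarith
    rcases le_or_gt (a j) 1 with h3 | h3
    · exact h3.trans hA1
    · have := le_self_pow₀ h3.le (n := 4) (by norm_num)
      rw [hA₀]; linarith
  have hν : pastSum a p k ≤ p * A₀ := pastSum_le_of_le hA1 ha p
  have hgc : g k ≤ X ∧ c k ≤ Y := by
    rcases k with _ | j
    · exact ⟨h.grad_zero.trans (by linarith), h.curv_zero.trans (by linarith)⟩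
    · have hj : j ≤ N := by omega
      have hμ : a j + pastSum a p j ≤ (p + 1) * A₀ := by
        have := pastSum_le_of_le hA1 (fun i hi => ha i (by omega)) p (k := j)
        have := ha j (by omega)
        linarith
      have hμ0 : 0 ≤ a j + pastSum a p j :=
        add_nonneg (h.nonneg j) (pastSum_nonneg h.nonneg p j)
      have hσj : σ j ≤ S := (h.σ_mono hσ₀ (Nat.le_succ j)).trans hkS
      constructor
      · refine (h.grad j hj).trans ?_
        rw [hX]
        have : (θ * σ j + D) * (a j + pastSum a p j) ^ 3 ≤
            (θ * S + D) * ((p + 1) * A₀) ^ 3 := by gcongr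
        linarith
      · refine (h.curv j hj).trans ?_
        rw [hY]
        have : (θ * σ j + D) * (a j + pastSum a p j) ^ 2 ≤
            (θ * S + D) * ((p + 1) * A₀) ^ 2 := by gcongr
        linarith
  have hak := h.nonneg k
  refine le_max_of_quartic_le (by positivity) (by positivity) (by positivity) ?_
  have h1 := h.step k hk
  have h2 : σ₀ / 24 * a k ^ 4 ≤ σ k / 24 * a k ^ 4 := by
    gcongr
    exact h.le_σ hσ₀ k
  have h3 : g k * a k ≤ X * a k := mul_le_mul_of_nonneg_right hgc.1 hak
  have h4 : c k * a k ^ 2 ≤ Y * a k ^ 2 := mul_le_mul_of_nonneg_right hgc.2 (by positivity)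
  have h5 : (κ + D * pastSum a p k) * a k ^ 3 ≤ Z * a k ^ 3 := by
    rw [hZ]
    gcongr
  linarith

theorem exists_σ_bound (p : ℕ) {σ₀ θ D κ Δ G B : ℝ} (hσ₀ : 0 < σ₀) (hθ : 0 ≤ θ)
    (hD : 0 ≤ D) (hG : 0 ≤ G) (hB : 0 ≤ B) :
    ∃ U : ℝ, ∀ (a σ F g c : ℕ → ℝ) (N : ℕ), IsStepSequence p σ₀ θ D κ Δ G B a σ F g c N →
      ∀ k ≤ N + 1, σ k ≤ U := by
  set Q : ℝ := D * (p + 1 : ℝ) ^ 4 with hQ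
  have hQ0 : 0 ≤ Q := by positivity
  -- Beyond this threshold `Q a⁴` is at most `σ a⁴ / 48`, half of the model decrease `σ a⁴ / 24`.
  set S : ℝ := σ₀ + 48 * Q with hS
  have hSσ : σ₀ ≤ S := by linarith
  obtain ⟨A, hA⟩ := exists_step_bound p (κ := κ) Δ hσ₀ hθ hD hG hB hSσ
  set V : ℝ := S * (1 + A ^ 4) with hV
  have hV0 : 0 ≤ V := by
    have : 0 ≤ S := by linarith
    positivity
  refine ⟨σ₀ + 48 * (Δ + Q * p) + 48 * Q * (V / σ₀), fun a σ F g c N h K hK => ?_⟩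
  -- After the last index with `σ k ≤ S` the parameter is at most `V`, and it already contains all
  -- the increments that count here.
  have hsmall : ∀ k ≤ N + 1,
      ∑ j ∈ Finset.range k, (if σ j ≤ S then σ₀ * a j ^ 4 else 0) ≤ V := by
    intro k hk
    induction k with
    | zero => simpa using hV0
    | succ k ih =>
      by_cases hkS : σ k ≤ S
      · have h1 : ∑ j ∈ Finset.range (k + 1), (if σ j ≤ S then σ₀ * a j ^ 4 else 0) ≤
            ∑ j ∈ Finset.range (k + 1), σ j * a j ^ 4 := by
          refine Finset.sum_le_sum fun j _ => ?_
          have h2 := mul_le_mul_of_nonneg_right (h.le_σ hσ₀ j) (pow_nonneg (h.nonneg j) 4)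
          split_ifs
          · exact h2
          · exact (mul_nonneg hσ₀.le (pow_nonneg (h.nonneg j) 4)).trans h2
        have h3 := h.σ_eq (k + 1)
        have h4 : σ (k + 1) ≤ V := by
          rw [h.σ_succ, hV]
          have hak := h.nonneg k
          have h5 : a k ^ 4 ≤ A ^ 4 := by
            have := hA a σ F g c N h k (by omega) hkS
            gcongr
          have h6 : σ k * a k ^ 4 ≤ S * A ^ 4 := by
            have := h.le_σ hσ₀ k
            gcongr
          linarith
        linarith
      · rw [Finset.sum_range_succ, if_neg hkS, add_zero]
        exact ih (by omega)
  have hdesc : ∑ k ∈ Finset.range K, σ k / 24 * a k ^ 4 ≤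
      Δ + Q * (∑ k ∈ Finset.range K, a k ^ 4 + p) := by
    have h1 : ∑ k ∈ Finset.range K, (F (k + 1) - F k + σ k / 24 * a k ^ 4) ≤
        ∑ k ∈ Finset.range K, D * (a k + pastSum a p k) ^ 4 :=
      Finset.sum_le_sum fun k hk => h.descent k (by have := Finset.mem_range.1 hk; omega)
    rw [Finset.sum_add_distrib, Finset.sum_range_sub, ← Finset.mul_sum] at h1
    have h2 := mul_le_mul_of_nonneg_left (sum_add_pastSum_pow_le h.nonneg p K) hD
    have h3 := h.gap K
    rw [← mul_assoc, ← hQ] at h2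
    linarith
  -- The term `-48 Q a⁴` will cancel the error in `hdesc`; the correction is needed only where `σ k
  -- ≤ S`.
  have hpt : ∑ k ∈ Finset.range K, σ k * a k ^ 4 ≤
      ∑ k ∈ Finset.range K, (48 * (σ k / 24 * a k ^ 4) - 48 * Q * a k ^ 4 +
        48 * Q / σ₀ * (if σ k ≤ S then σ₀ * a k ^ 4 else 0)) := by
    refine Finset.sum_le_sum fun k _ => ?_
    have h4 : 0 ≤ a k ^ 4 := pow_nonneg (h.nonneg k) 4
    have hσk := h.le_σ hσ₀ k
    split_ifs with hk
    · have : 48 * Q / σ₀ * (σ₀ * a k ^ 4) = 48 * Q * a k ^ 4 := by field_simp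
      rw [this]
      have := mul_nonneg (hσ₀.le.trans hσk) h4
      linarith
    · have h5 : 48 * Q ≤ σ k := by linarith [not_le.1 hk]
      have := mul_le_mul_of_nonneg_right h5 h4
      linarith
  rw [Finset.sum_add_distrib, Finset.sum_sub_distrib, ← Finset.mul_sum, ← Finset.mul_sum,
    ← Finset.mul_sum] at hpt
  have hsm := mul_le_mul_of_nonneg_left (hsmall K hK) (show 0 ≤ 48 * Q / σ₀ by positivity)
  have heq : 48 * Q / σ₀ * V = 48 * Q * (V / σ₀) := by ring
  have := h.σ_eq K
  linarith

/-- Raising to the power `q = 4 / j` turns the first-order (`j = 3`) and second-order (`j = 2`)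
failures into the same lower bound on `μ ^ 4`. -/
theorem one_le_of_lt_mul {ε C μ M q : ℝ} {j : ℕ} (hε : 0 < ε) (hC : 1 ≤ C) (hμ : 0 ≤ μ)
    (hq : 0 < q) (hq2 : q ≤ 2) (hj : (j : ℝ) * q = 4) (hM : ε ^ (-q) ≤ M) (h : ε < C * μ ^ j) :
    1 ≤ C ^ 2 * M * μ ^ 4 := by
  have hC0 : 0 ≤ C := by linarith
  have h1 : ε ^ q ≤ C ^ 2 * μ ^ 4 := by
    calc ε ^ q ≤ (C * μ ^ j) ^ q := Real.rpow_le_rpow hε.le h.le hq.le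
      _ = C ^ q * μ ^ 4 := by
          rw [Real.mul_rpow hC0 (by positivity), ← Real.rpow_natCast μ j,
            ← Real.rpow_mul hμ, hj]
          norm_cast
      _ ≤ C ^ 2 * μ ^ 4 := by
          gcongr
          rw [← Real.rpow_natCast C 2]
          exact Real.rpow_le_rpow_of_exponent_le hC (by exact_mod_cast hq2)
  have h2 : ε ^ (-q) * ε ^ q = 1 := by
    rw [← Real.rpow_add hε]; simp
  have h3 : 0 < ε ^ (-q) := Real.rpow_pos_of_pos hε _
  calc 1 = ε ^ (-q) * ε ^ q := h2.symm
    _ ≤ M * (C ^ 2 * μ ^ 4) := mul_le_mul hM h1 (by positivity) (h3.le.trans hM)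
    _ = _ := by ring

theorem one_le_max_rpow {ε₁ ε₂ : ℝ} (h₁ : 0 < ε₁) (h₂ : 0 < ε₂) (h : min ε₁ ε₂ ≤ 1) :
    1 ≤ max (ε₁ ^ (-(4 / 3) : ℝ)) (ε₂ ^ (-2 : ℝ)) := by
  rcases min_le_iff.1 h with h | h
  · exact le_max_of_le_left (Real.one_le_rpow_of_pos_of_le_one_of_nonpos h₁ h (by norm_num))
  · exact le_max_of_le_right (Real.one_le_rpow_of_pos_of_le_one_of_nonpos h₂ h (by norm_num))

theorem exists_complexity_bound (p : ℕ) {σ₀ θ D κ Δ G B : ℝ} (hσ₀ : 0 < σ₀) (hθ : 0 ≤ θ)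
    (hD : 0 ≤ D) (hG : 0 ≤ G) (hB : 0 ≤ B) :
    ∃ C : ℝ, 0 < C ∧ ∀ (a σ F g c : ℕ → ℝ) (N : ℕ),
      IsStepSequence p σ₀ θ D κ Δ G B a σ F g c N →
      ∀ ε₁ ε₂ : ℝ, 0 < ε₁ → 0 < ε₂ → min ε₁ ε₂ ≤ 1 →
        (∀ k ≤ N, ε₁ < g k ∨ ε₂ < c k) →
        (N + 1 : ℝ) ≤ C * max (ε₁ ^ (-(4 / 3) : ℝ)) (ε₂ ^ (-2 : ℝ)) := by
  obtain ⟨U, hU⟩ := exists_σ_bound p (κ := κ) (Δ := Δ) hσ₀ hθ hD hG hB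
  set E : ℝ := 1 + θ * |U| + D with hE
  have hE1 : 1 ≤ E := by
    have : 0 ≤ θ * |U| := by positivity
    linarith
  set W : ℝ := E ^ 2 * ((p + 1 : ℝ) ^ 4 * (|U| / σ₀ + p)) with hW
  have hW0 : 0 ≤ W := by positivity
  refine ⟨W + 1, by linarith, fun a σ F g c N h ε₁ ε₂ h₁ h₂ hmin hbad => ?_⟩
  set M := max (ε₁ ^ (-(4 / 3) : ℝ)) (ε₂ ^ (-2 : ℝ))
  have hM : 1 ≤ M := one_le_max_rpow h₁ h₂ hmin
  -- Failure at `k + 1` is charged to step `k`; the uncharged iterate `0` is absorbed at the end by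
  -- `1 ≤ M`.
  have hpt : ∀ k ∈ Finset.range N, 1 ≤ E ^ 2 * M * (a k + pastSum a p k) ^ 4 := by
    intro k hk
    have hkN := Finset.mem_range.1 hk
    have hμ0 : 0 ≤ a k + pastSum a p k :=
      add_nonneg (h.nonneg k) (pastSum_nonneg h.nonneg p k)
    have hEk : θ * σ k + D ≤ E := by
      have : σ k ≤ |U| := (hU a σ F g c N h k (by omega)).trans (le_abs_self U)
      have := mul_le_mul_of_nonneg_left this hθ
      linarith
    rcases hbad (k + 1) (by omega) with hb | hb
    · have h3 := hb.trans_le ((h.grad k hkN.le).trans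
        (mul_le_mul_of_nonneg_right hEk (by positivity)))
      exact one_le_of_lt_mul h₁ hE1 hμ0 (q := 4 / 3) (by norm_num) (by norm_num) (by norm_num)
        (le_max_left _ _) h3
    · have h3 := hb.trans_le ((h.curv k hkN.le).trans
        (mul_le_mul_of_nonneg_right hEk (by positivity)))
      exact one_le_of_lt_mul h₂ hE1 hμ0 (q := 2) (by norm_num) (by norm_num) (by norm_num)
        (le_max_right _ _) h3
  have hsum := Finset.sum_le_sum hpt
  rw [← Finset.mul_sum] at hsum
  simp only [Finset.sum_const, Finset.card_range, nsmul_eq_mul, mul_one] at hsum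
  have h3 : ∑ k ∈ Finset.range N, a k ^ 4 ≤ |U| / σ₀ :=
    (h.sum_pow_le hσ₀ N).trans (by
      gcongr
      exact (hU a σ F g c N h N (by omega)).trans (le_abs_self U))
  have h4 : ∑ k ∈ Finset.range N, (a k + pastSum a p k) ^ 4 ≤
      (p + 1 : ℝ) ^ 4 * (|U| / σ₀ + p) :=
    (sum_add_pastSum_pow_le h.nonneg p N).trans (by gcongr)
  have h5 : (N : ℝ) ≤ W * M := by
    calc (N : ℝ) ≤ _ := hsum
      _ ≤ E ^ 2 * M * ((p + 1 : ℝ) ^ 4 * (|U| / σ₀ + p)) := by gcongr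
      _ = W * M := by rw [hW]; ring
  linarith

/-! ### Runs of the algorithm -/

theorem IsTrialStep.isApproxSecondOrder_of_eq_zero {n : ℕ} {f : Vec n → ℝ}
    (hf : ContDiff ℝ 2 f) {θ₁ θ₂ σ ε₁ ε₂ : ℝ} {x s : Vec n} {T : Tensor 3 n}
    (h : IsTrialStep f θ₁ θ₂ x T σ s) (hs : s = 0) (h₁ : 0 < ε₁) (h₂ : 0 < ε₂) :
    IsApproxSecondOrder f ε₁ ε₂ x := by
  subst hs
  have hg := h.first_order
  have hc := h.second_order
  have hM : hessMatrix (approxTaylor f x T) 0 = hessMatrix f x := by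
    simp only [hessMatrix, iteratedFDeriv_two_approxTaylor_zero hf]
  rw [norm_gradient_eq, iteratedFDeriv_one_approxTaylor_zero, ← norm_gradient_eq] at hg
  rw [hM] at hc
  simp only [norm_zero, ne_eq, OfNat.ofNat_ne_zero, not_false_eq_true, zero_pow, mul_zero,
    zero_div] at hg hc
  refine ⟨hg.trans h₁.le, ?_⟩
  have := (le_max_right _ _).trans hc
  linarith

theorem IsTrialStep.approxTaylor_le {n : ℕ} {f : Vec n → ℝ} {θ₁ θ₂ σ : ℝ} {x s : Vec n}
    {T : Tensor 3 n} (h : IsTrialStep f θ₁ θ₂ x T σ s) :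
    approxTaylor f x T s + σ / 24 * ‖s‖ ^ 4 ≤ f x := by
  have := h.decrease
  simp only [model, approxTaylor_zero, norm_zero, Nat.factorial] at this
  norm_num at this
  linarith

theorem IsTrialStep.step_bound {n : ℕ} {f : Vec n → ℝ} (hf : ContDiff ℝ 2 f)
    {θ₁ θ₂ σ : ℝ} {x s : Vec n} {T : Tensor 3 n} (h : IsTrialStep f θ₁ θ₂ x T σ s) :
    σ / 24 * ‖s‖ ^ 4 ≤ ‖gradient f x‖ * ‖s‖ +
      max 0 (-lambdaMin (hessMatrix f x)) * ‖s‖ ^ 2 + ‖T‖ * ‖s‖ ^ 3 := by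
  have h0 := h.approxTaylor_le
  rw [approxTaylor_eq] at h0
  simp only [Pi.add_apply, Pi.smul_apply, smul_eq_mul] at h0
  have h1 := (iteratedFDeriv ℝ 1 f x).le_opNorm fun _ => s
  have h2 := lambdaMin_mul_sq_le hf x s
  have h3 := T.le_opNorm fun _ => s
  rw [← norm_gradient_eq] at h1
  simp only [Finset.prod_const, Finset.card_univ, Fintype.card_fin, pow_one,
    Real.norm_eq_abs] at h1 h3
  have h1' := (abs_le.1 h1).1
  have h3' := (abs_le.1 h3).1
  have h4 := mul_le_mul_of_nonneg_right (le_max_right 0 (-lambdaMin (hessMatrix f x)))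
    (sq_nonneg ‖s‖)
  have h5 : 0 ≤ max 0 (-lambdaMin (hessMatrix f x)) * ‖s‖ ^ 2 :=
    mul_nonneg (le_max_left _ _) (sq_nonneg _)
  have h6 : 0 ≤ ‖T‖ * ‖s‖ ^ 3 := by positivity
  linarith

theorem IsTrialStep.grad_le {n : ℕ} {f : Vec n → ℝ} {θ₁ θ₂ σ : ℝ} {x s : Vec n}
    {T : Tensor 3 n} (h : IsTrialStep f θ₁ θ₂ x T σ s) :
    ‖gradient f (x + s)‖ ≤ θ₁ * σ * ‖s‖ ^ 3 / 6 +
      ‖iteratedFDeriv ℝ 1 f (x + s) - iteratedFDeriv ℝ 1 (approxTaylor f x T) s‖ := by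
  have h1 := h.first_order
  rw [norm_gradient_eq, show ((Nat.factorial 3 : ℕ) : ℝ) = 6 by norm_num [Nat.factorial]] at h1
  rw [norm_gradient_eq]
  have h2 := norm_le_norm_add_norm_sub' (iteratedFDeriv ℝ 1 f (x + s))
    (iteratedFDeriv ℝ 1 (approxTaylor f x T) s)
  linarith

theorem IsTrialStep.curv_le {n : ℕ} (hn : 1 ≤ n) {f : Vec n → ℝ} (hf : ContDiff ℝ 2 f)
    {θ₁ θ₂ σ : ℝ} {x s : Vec n} {T : Tensor 3 n} (h : IsTrialStep f θ₁ θ₂ x T σ s) :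
    max 0 (-lambdaMin (hessMatrix f (x + s))) ≤ θ₂ * σ * ‖s‖ ^ 2 / 2 +
      ‖iteratedFDeriv ℝ 2 f (x + s) - iteratedFDeriv ℝ 2 (approxTaylor f x T) s‖ := by
  have h1 := h.second_order
  have h2 := lambdaMin_le_add hn hf (contDiff_approxTaylor f x T) (x + s) s
  norm_num [Nat.factorial] at h1
  have h3 := norm_nonneg
    (iteratedFDeriv ℝ 2 f (x + s) - iteratedFDeriv ℝ 2 (approxTaylor f x T) s)
  exact max_le (by linarith) (by linarith)

theorem IsRun.isStepSequence {n : ℕ} (hn : 1 ≤ n) {f : Vec n → ℝ} {flow L κ : ℝ}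
    (hf : ObjectiveAssumptions f flow L κ) {θ₁ θ₂ σ₀ : ℝ} (hσ₀ : 0 < σ₀) (hθ₁ : 0 ≤ θ₁)
    (hθ₂ : 0 ≤ θ₂) {x₀ : Vec n} {Δ G B : ℝ} (hx₀ : StartBounds f flow x₀ Δ G B)
    {R : Iterates n} (hR : IsRun f θ₁ θ₂ σ₀ x₀ R) (hsymm : ∀ k, IsSymmTensor (R.T k))
    {p N : ℕ} (herr : ∀ k ≤ N, ‖R.T k - iteratedFDeriv ℝ 3 f (R.x k)‖ ≤
      2 * L * pastSum (fun k => ‖R.s k‖) p k) :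
    IsStepSequence p σ₀ (θ₁ + θ₂) (2 * L) κ Δ G B (fun k => ‖R.s k‖) R.σ
      (fun k => f (R.x k)) (fun k => ‖gradient f (R.x k)‖)
      (fun k => max 0 (-lambdaMin (hessMatrix f (R.x k)))) N := by
  have hL0 : 0 ≤ L := by linarith [hf.three_le]
  have hf2 : ContDiff ℝ 2 f := hf.smooth.of_le (by norm_num)
  have ha : ∀ k, 0 ≤ ‖R.s k‖ := fun k => norm_nonneg _
  have hσ : ∀ k, 0 < R.σ k := by
    intro k
    induction k with
    | zero => rw [hR.σ_zero]; exact hσ₀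
    | succ k ih => rw [hR.σ_succ]; positivity
  have hν := pastSum_nonneg ha p
  -- This is where `D = 2 * L` comes from: the Lipschitz term `L‖s‖` and the tensor error merge into
  -- one power of `μ`.
  have hrem : ∀ k ≤ N, ∀ j, (L * ‖R.s k‖ + 2 * L * pastSum (fun k => ‖R.s k‖) p k) *
      ‖R.s k‖ ^ j ≤ 2 * L * (‖R.s k‖ + pastSum (fun k => ‖R.s k‖) p k) ^ (j + 1) := by
    intro k _ j
    have h1 := ha k
    have h2 := hν k
    rw [pow_succ', ← mul_assoc]
    have h3 : ‖R.s k‖ ≤ ‖R.s k‖ + pastSum (fun k => ‖R.s k‖) p k := by linarith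
    gcongr
    have := mul_nonneg hL0 h1
    linarith
  have hmu : ∀ k j, ‖R.s k‖ ^ j ≤ (‖R.s k‖ + pastSum (fun k => ‖R.s k‖) p k) ^ j :=
    fun k j => pow_le_pow_left₀ (ha k) (by linarith [hν k]) j
  have htay := fun k (hk : k ≤ N) =>
    approxTaylor_remainder hf.smooth hf.lipschitz hL0 (hsymm k) (herr k hk) (R.s k)
  refine ⟨ha, hR.σ_zero, hR.σ_succ, fun k => ?_, ?_, ?_, fun k hk => ?_, fun k hk => ?_,
    fun k hk => ?_, fun k hk => ?_⟩
  · have := hf.bounded_below (R.x k)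
    have := hx₀.gap
    rw [hR.x_zero]
    linarith
  · rw [hR.x_zero]; exact hx₀.grad
  · rw [hR.x_zero]; exact hx₀.curv
  · have h1 := (hR.step k).approxTaylor_le
    have h2 := (abs_le.1 ((htay k hk).1.trans (hrem k hk 3))).2
    simp only [Nat.reduceAdd] at h2
    rw [← hR.x_succ] at h2
    linarith
  · refine ((hR.step k).step_bound hf2).trans ?_
    have h1 := norm_le_norm_add_norm_sub' (R.T k) (iteratedFDeriv ℝ 3 f (R.x k))
    have h2 := hf.bounded_third (R.x k)
    have h3 : ‖R.T k‖ ≤ κ + 2 * L * pastSum (fun k => ‖R.s k‖) p k := by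
      linarith [herr k hk]
    gcongr
  · have h1 := (hR.step k).grad_le
    have h2 := (htay k hk).2.1.trans (hrem k hk 2)
    simp only [Nat.reduceAdd] at h2
    have h4 : θ₁ * R.σ k * ‖R.s k‖ ^ 3 ≤
        (θ₁ + θ₂) * R.σ k * (‖R.s k‖ + pastSum (fun k => ‖R.s k‖) p k) ^ 3 := by
      have := hmu k 3
      have := (hσ k).le
      gcongr
      linarith
    have h5 : 0 ≤ θ₁ * R.σ k * ‖R.s k‖ ^ 3 := by have := (hσ k).le; positivity
    rw [← hR.x_succ] at h1 h2
    rw [add_mul]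
    linarith
  · have h1 := (hR.step k).curv_le hn hf2
    have h2 := (htay k hk).2.2.trans (by simpa using hrem k hk 1)
    have h4 : θ₂ * R.σ k * ‖R.s k‖ ^ 2 ≤
        (θ₁ + θ₂) * R.σ k * (‖R.s k‖ + pastSum (fun k => ‖R.s k‖) p k) ^ 2 := by
      have := hmu k 2
      have := (hσ k).le
      gcongr
      linarith
    have h5 : 0 ≤ θ₂ * R.σ k * ‖R.s k‖ ^ 2 := by have := (hσ k).le; positivity
    rw [← hR.x_succ] at h1 h2
    rw [add_mul]
    linarith

theorem PSBBetweenRestarts.error_le {n : ℕ} {f : Vec n → ℝ} {flow L κ : ℝ}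
    (hf : ObjectiveAssumptions f flow L κ) {m : ℕ} (hm : 1 ≤ m) {R : Iterates n}
    (hR : PSBBetweenRestarts f m R) (hx : ∀ k, R.x (k + 1) = R.x k + R.s k)
    (hsymm : ∀ k, IsSymmTensor (R.T k)) {N : ℕ}
    (hrestart : ∀ k ≤ N, k % m = 0 → ‖R.T k - iteratedFDeriv ℝ 3 f (R.x k)‖ ≤
      2 * L * pastSum (fun k => ‖R.s k‖) m k) (k : ℕ) (hk : k ≤ N) :
    ‖R.T k - iteratedFDeriv ℝ 3 f (R.x k)‖ ≤ 2 * L * pastSum (fun k => ‖R.s k‖) (2 * m) k := by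
  have hL0 : 0 ≤ L := by linarith [hf.three_le]
  -- The window has length `m` at a restart and grows by one with each update, since the error added
  -- is the latest step.
  have key : ∀ k ≤ N, ‖R.T k - iteratedFDeriv ℝ 3 f (R.x k)‖ ≤
      2 * L * pastSum (fun k => ‖R.s k‖) (m + k % m) k := by
    intro k
    induction k with
    | zero => intro h0; simpa using hrestart 0 h0 (Nat.zero_mod m)
    | succ k ih =>
      intro hk
      by_cases hkm : (k + 1) % m = 0
      · rw [hkm]
        exact hrestart _ hk hkm
      · have hmod : (k + 1) % m = k % m + 1 := by
          rw [Nat.add_mod]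
          rcases Nat.lt_or_ge 1 m with h1 | h1
          · rw [Nat.mod_eq_of_lt h1]
            refine Nat.mod_eq_of_lt ?_
            have h2 := Nat.mod_lt k hm
            by_contra h3
            have h4 : k % m + 1 = m := by omega
            apply hkm
            rw [Nat.add_mod, Nat.mod_eq_of_lt h1, h4, Nat.mod_self]
          · have : m = 1 := le_antisymm h1 hm
            subst this
            exact absurd (Nat.mod_one _) hkm
        have h1 := hR (k + 1) hkm
        rw [Nat.add_sub_cancel, hx k] at h1
        have h2 := norm_psb_error_le hf.smooth hf.lipschitz hL0 (hsymm k) h1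
        rw [← hx k] at h2
        have h3 := ih (by omega)
        rw [hmod, ← add_assoc, pastSum_succ, mul_add]
        linarith
  refine (key k hk).trans ?_
  have := Nat.mod_lt k hm
  gcongr
  exact pastSum_mono (fun _ => norm_nonneg _) (by omega) k

theorem PSBBetweenRestarts.isSymmTensor {n : ℕ} {f : Vec n → ℝ} {m : ℕ} {R : Iterates n}
    (hR : PSBBetweenRestarts f m R) (h : ∀ k, k % m = 0 → IsSymmTensor (R.T k)) (k : ℕ) :
    IsSymmTensor (R.T k) := by
  by_cases hk : k % m = 0
  · exact h k hk
  · exact (hR k hk).1.1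

theorem fdStep_eq {n : ℕ} (m : ℕ) (R : Iterates n) (k : ℕ) :
    fdStep m R k = min (pastSum (fun k => ‖R.s k‖) m k) 1 / Real.sqrt n := by
  rw [fdStep, pastSum, Finset.range_eq_Ico,
    Finset.sum_Ico_add' (fun i => pastLength (fun k => ‖R.s k‖) k i) 0 m 1]
  rfl

theorem norm_fdRestart_error_le {n : ℕ} (hn : 1 ≤ n) {f : Vec n → ℝ} {flow L κ : ℝ}
    (hf : ObjectiveAssumptions f flow L κ) {m : ℕ} (hm : 1 ≤ m) {R : Iterates n} {k : ℕ}
    (hs : ∀ j < k, R.s j ≠ 0) :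
    ‖symProj (fdTensor f (R.x k) (fdStep m R k)) - iteratedFDeriv ℝ 3 f (R.x k)‖ ≤
      2 * L * pastSum (fun k => ‖R.s k‖) m k := by
  have hL0 : 0 ≤ L := by linarith [hf.three_le]
  have hn0 : 0 < Real.sqrt n := Real.sqrt_pos.2 (by exact_mod_cast hn)
  -- The latest length suffices; at `k = 0` it is the conventional `1`.
  have hpos : 0 < pastSum (fun k => ‖R.s k‖) m k := by
    have h1 : pastSum (fun k => ‖R.s k‖) 1 k ≤ pastSum (fun k => ‖R.s k‖) m k :=
      pastSum_mono (fun _ => norm_nonneg _) hm k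
    refine lt_of_lt_of_le ?_ h1
    simp only [pastSum, Finset.sum_range_one, pastLength]
    split_ifs with h
    · exact norm_pos_iff.2 (hs _ (by omega))
    · exact one_pos
  have hh : 0 < fdStep m R k := by
    rw [fdStep_eq]
    exact div_pos (lt_min hpos one_pos) hn0
  refine (norm_symProj_fdTensor_sub_le hf.smooth hf.lipschitz hL0 _ hh).trans ?_
  rw [fdStep_eq, div_mul_cancel₀ _ hn0.ne']
  have h1 := mul_le_mul_of_nonneg_left
    (min_le_left (pastSum (fun k => ‖R.s k‖) m k) 1) hL0
  have h2 := mul_nonneg hL0 hpos.le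
  linarith

theorem exists_iteration_bound (m : ℕ) (hm : 1 ≤ m) {σ₀ θ₁ θ₂ : ℝ} (hσ₀ : 0 < σ₀)
    (hθ₁ : 0 ≤ θ₁) (hθ₂ : 0 ≤ θ₂) (L κ Δ G B : ℝ) :
    ∃ C : ℝ, 0 < C ∧
      ∀ (n : ℕ), 1 ≤ n → ∀ (f : Vec n → ℝ) (flow : ℝ) (x₀ : Vec n),
        ObjectiveAssumptions f flow L κ → StartBounds f flow x₀ Δ G B →
        ∀ R : Iterates n, IsRun f θ₁ θ₂ σ₀ x₀ R → PSBBetweenRestarts f m R →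
        (∀ k, k % m = 0 → IsSymmTensor (R.T k)) →
        (∀ k, k % m = 0 → (∀ j < k, R.s j ≠ 0) →
          ‖R.T k - iteratedFDeriv ℝ 3 f (R.x k)‖ ≤ 2 * L * pastSum (fun k => ‖R.s k‖) m k) →
        ∀ ε₁ ε₂ : ℝ, 0 < ε₁ → 0 < ε₂ → min ε₁ ε₂ ≤ 1 →
          ∃ K : ℕ, IsApproxSecondOrder f ε₁ ε₂ (R.x K) ∧
            (K : ℝ) ≤ C * max (ε₁ ^ (-(4 / 3) : ℝ)) (ε₂ ^ (-2 : ℝ)) := by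
  -- `C` is chosen before any objective is given; if one of these bounds is negative, no objective
  -- qualifies.
  by_cases hpar : 0 ≤ L ∧ 0 ≤ G ∧ 0 ≤ B
  swap
  · refine ⟨1, one_pos, fun n hn f flow x₀ hf hx₀ => absurd ⟨?_, ?_, ?_⟩ hpar⟩
    · linarith [hf.three_le]
    · exact (norm_nonneg _).trans hx₀.grad
    · exact (le_max_left _ _).trans hx₀.curv
  obtain ⟨hL0, hG, hB⟩ := hpar
  obtain ⟨C, hC, hbound⟩ := exists_complexity_bound (2 * m) (κ := κ) (Δ := Δ) hσ₀
    (add_nonneg hθ₁ hθ₂) (mul_nonneg zero_le_two hL0) hG hB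
  refine ⟨C, hC, fun n hn f flow x₀ hf hx₀ R hR hpsb hsymm hrestart ε₁ ε₂ h₁ h₂ hmin => ?_⟩
  set M := max (ε₁ ^ (-(4 / 3) : ℝ)) (ε₂ ^ (-2 : ℝ))
  by_contra! hcon
  have hM : 1 ≤ M := one_le_max_rpow h₁ h₂ hmin
  set N := ⌊C * M⌋₊
  have hbad : ∀ k ≤ N, ¬ IsApproxSecondOrder f ε₁ ε₂ (R.x k) := fun k hk h =>
    (hcon k h).not_ge ((Nat.cast_le.2 hk).trans (Nat.floor_le (by positivity)))
  -- A zero step certifies exact stationarity of its iterate, so before success every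
  -- finite-difference stepsize is positive.
  have hs : ∀ k ≤ N, R.s k ≠ 0 := fun k hk h0 =>
    hbad k hk ((hR.step k).isApproxSecondOrder_of_eq_zero (hf.smooth.of_le (by norm_num))
      h0 h₁ h₂)
  have hsymm' := hpsb.isSymmTensor hsymm
  have herr := hpsb.error_le hf hm hR.x_succ hsymm' (N := N)
    fun k hk hkm => hrestart k hkm fun j hj => hs j (by omega)
  have hseq := hR.isStepSequence hn hf hσ₀ hθ₁ hθ₂ hx₀ hsymm' herr
  have h := hbound _ _ _ _ _ N hseq ε₁ ε₂ h₁ h₂ hmin fun k hk => by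
    by_contra! hc
    exact hbad k hk ⟨hc.1, by linarith [(le_max_right _ _).trans hc.2]⟩
  exact absurd h (not_le.2 (Nat.lt_floor_add_one _))

/-! ### Counting oracle calls -/

theorem evalCount_le {n : ℕ} {queries : ℕ → List (Query n)} {q : ℕ}
    (h : ∀ k, (queries k).length ≤ q) (K : ℕ) : evalCount queries K ≤ (K + 1) * q := by
  simpa [evalCount] using Finset.sum_le_card_nsmul (Finset.range (K + 1)) _ q fun k _ => h k

theorem evalCount_le_of_iteration_bound {n : ℕ} {queries : ℕ → List (Query n)} {q K : ℕ}
    (h : ∀ k, (queries k).length ≤ q) {C M : ℝ} (hM : 1 ≤ M) (hK : (K : ℝ) ≤ C * M) :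
    (evalCount queries K : ℝ) ≤ (C + 1) * M * q := by
  have h1 : (evalCount queries K : ℝ) ≤ ((K : ℝ) + 1) * q := by exact_mod_cast evalCount_le h K
  refine h1.trans (mul_le_mul_of_nonneg_right ?_ (Nat.cast_nonneg q))
  linarith

end PSBThree

theorem mainTheorem5 (m : ℕ) (hm : 1 ≤ m) (σ₀ θ₁ θ₂ : ℝ) (hσ₀ : 0 < σ₀) (hθ₁ : 1 < θ₁)
    (hθ₂ : 1 < θ₂) (L κ Δ G B : ℝ) :
    (∃ C : ℝ, 0 < C ∧
      ∀ (n : ℕ), 1 ≤ n → ∀ (f : Vec n → ℝ) (flow : ℝ) (x₀ : Vec n),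
        ObjectiveAssumptions f flow L κ → StartBounds f flow x₀ Δ G B →
        ∀ R : Iterates n, IsLazyRestartRun f m θ₁ θ₂ σ₀ x₀ R →
        ∀ ε₁ ε₂ : ℝ, 0 < ε₁ → 0 < ε₂ → min ε₁ ε₂ ≤ 1 →
          ∃ K : ℕ, IsApproxSecondOrder f ε₁ ε₂ (R.x K) ∧
            (evalCount (lazyQueries m R) K : ℝ)
              ≤ C * max (ε₁ ^ (-(4 / 3) : ℝ)) (ε₂ ^ (-2 : ℝ))) ∧
    (∃ C : ℝ, 0 < C ∧
      ∀ (n : ℕ), 1 ≤ n → ∀ (f : Vec n → ℝ) (flow : ℝ) (x₀ : Vec n),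
        ObjectiveAssumptions f flow L κ → StartBounds f flow x₀ Δ G B →
        ∀ R : Iterates n, IsFDRestartRun f m θ₁ θ₂ σ₀ x₀ R →
        ∀ ε₁ ε₂ : ℝ, 0 < ε₁ → 0 < ε₂ → min ε₁ ε₂ ≤ 1 →
          ∃ K : ℕ, IsApproxSecondOrder f ε₁ ε₂ (R.x K) ∧
            (evalCount (fdQueries m R) K : ℝ)
              ≤ C * (n * max (ε₁ ^ (-(4 / 3) : ℝ)) (ε₂ ^ (-2 : ℝ)))) := by
  obtain ⟨C, hC, hbound⟩ := exists_iteration_bound m hm hσ₀ (zero_le_one.trans hθ₁.le)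
    (zero_le_one.trans hθ₂.le) L κ Δ G B
  -- An iteration makes at most `3` calls, respectively `n + 2 ≤ 3 * n`; `C + 1` accounts for the `K
  -- + 1` iterations.
  refine ⟨⟨3 * (C + 1), by positivity, ?_⟩, ⟨3 * (C + 1), by positivity, ?_⟩⟩
  · intro n hn f flow x₀ hf hx₀ R hR ε₁ ε₂ h₁ h₂ hmin
    have hL0 : 0 ≤ L := by linarith [hf.three_le]
    obtain ⟨K, hK, hKC⟩ := hbound n hn f flow x₀ hf hx₀ R hR.run hR.psb
      (fun k hk => by rw [hR.restart k hk]; exact isSymmTensor_iteratedFDeriv_three hf.smooth _)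
      (fun k hk _ => by
        rw [hR.restart k hk, sub_self, norm_zero]
        exact mul_nonneg (by positivity) (pastSum_nonneg (fun _ => norm_nonneg _) m k))
      ε₁ ε₂ h₁ h₂ hmin
    refine ⟨K, hK, ?_⟩
    have hlen : ∀ k, (lazyQueries m R k).length ≤ 3 := fun k => by
      unfold lazyQueries; split_ifs <;> simp
    refine (evalCount_le_of_iteration_bound hlen (one_le_max_rpow h₁ h₂ hmin) hKC).trans_eq ?_
    push_cast
    ring
  · intro n hn f flow x₀ hf hx₀ R hR ε₁ ε₂ h₁ h₂ hmin
    obtain ⟨K, hK, hKC⟩ := hbound n hn f flow x₀ hf hx₀ R hR.run hR.psb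
      (fun k hk => by rw [hR.restart k hk]; exact isSymmTensor_symProj _)
      (fun k hk hs => by
        rw [hR.restart k hk]
        exact norm_fdRestart_error_le hn hf hm hs)
      ε₁ ε₂ h₁ h₂ hmin
    refine ⟨K, hK, ?_⟩
    have hlen : ∀ k, (fdQueries m R k).length ≤ 3 * n := fun k => by
      unfold fdQueries
      split_ifs
      · simp only [List.length_append, List.length_cons, List.length_nil, List.length_ofFn]
        omega
      · simp only [List.length_append, List.length_cons, List.length_nil]
        omega
    refine (evalCount_le_of_iteration_bound hlen (one_le_max_rpow h₁ h₂ hmin) hKC).trans_eq ?_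
    push_cast
    ring
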